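/- Write $\mathcal N_\rho$ ($\rho\in[0,1]$) for the binary symmetric channel that flips each bit independently with probability $(1-\rho)/2$, and call a function $\nu$ of the security parameter $\lambda$ negligible if $\lambda^{c}\,\nu(\lambda)\to 0$ for every $c\in\mathbb N$. A *crypto oracle* is a function $\mathcal B^{\mathcal R}:\{0,1\}^*\to\{0,1\}^*$, where $\mathcal B$ is a stateless deterministic polynomial-time Turing machine with oracle access to a secret uniformly random function $\mathcal R:\{0,1\}^*\to\{0,1\}$. A *private-key code relative to $\mathcal B^{\mathcal R}$* consists of probabilistic polynomial-time algorithms with oracle access to $\mathcal B^{\mathcal R}$: $\mathsf{KeyGen}(1^\lambda)$ outputs a key $\mathsf{sk}\in\{0,1\}^{\ell(\lambda)}$; $\mathsf{Enc}(1^\lambda,\mathsf{sk},m)$ maps a message $m\in\{0,1\}^{k(\lambda)}$ to a codeword in $\{0,1\}^{n(\lambda)}$; and $\mathsf{Dec}(1^\lambda,\mathsf{sk},c)$ maps $c\in\{0,1\}^{n(\lambda)}$ to an element of $\{0,1\}^{k(\lambda)}\cup\{\bot\}$. Here $k\ge 0$ is polynomially bounded ($k=0$ is the zero-bit case). All probabilities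 below are over $\mathcal R$ as well as all other randomness. * The code is *$\delta$-complete* for $\mathcal N_{\rho}$ if for all $\lambda$ and all $m\in\{0,1\}^{k(\lambda)}$, $\Pr[\mathsf{Dec}(\mathsf{sk},\mathcal N_{\rho(\lambda)}(\mathsf{Enc}(\mathsf{sk},m)))=m]\ge 1-\delta(\lambda)$. * It is *$\mu$-sound* if for all $\lambda$ and every fixed $c\in\{0,1\}^{n(\lambda)}$, $\Pr[\mathsf{Dec}(\mathsf{sk},c)=\bot]\ge 1-\mu(\lambda)$. * It is *statistically pseudorandom* if every computationally unbounded adversary that makes polynomially many queries, of polynomial total length, to $\mathcal B^{\mathcal R}$ and to an encoding oracle has negligible advantage in distinguishing the encoding oracle $\mathsf{Enc}(\mathsf{sk},\cdot)$ (fresh randomness in each call) from an oracle that answers each query with a fresh uniformly random string in $\{0,1\}^{n(\lambda)}$. **Statement.** Let $\mathcal B^{\mathcal R}$ be any crypto oracle and let $\rho:\mathbb N\to[0,1]$ satisfy $\rho=1-\Omega(1)$, i.e. there is a constant $c>0$ with $\rho(\lambda)\le 1-c$ for all sufficiently large $\lambda$. Then: 1. relative to $\mathcal B^{\mathcal R}$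 there is no statistically secure pseudorandom code for $\mathcal N_\rho$, i.e. no code that is statistically pseudorandom, $\delta$-complete for $\mathcal N_\rho$ and $\mu$-sound with negligible $\delta$ and $\mu$; 2. moreover, every private-key code relative to $\mathcal B^{\mathcal R}$ that is statistically pseudorandom, $\delta$-complete for $\mathcal N_\rho$ and $\mu$-sound (for arbitrary $\delta,\mu:\mathbb N\to\mathbb R$) has a negligible completeness–soundness gap: there is a negligible function $\nu$ with $\delta(\lambda)+\mu(\lambda)\ge 1-\nu(\lambda)$ for all $\lambda$. -/

import Mathlib

open MeasureTheory Filter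

/-! ### Probabilistic multi-tape Turing machines with an oracle -/

/-- The tapes of a machine with `a` input tapes and `w` work tapes.  Queries are written on `query`,
oracle answers appear on `answer`, and the result is written on `output`. -/
inductive TapeName (a w : ℕ) where
  | input (i : Fin a)
  | work (i : Fin w)
  | query
  | answer
  | output

inductive HeadMove where
  | left
  | stay
  | right

/-- A two-way infinite tape over the alphabet `{0, 1, blank}` (`none` is the blank):
the cells left of the head (nearest first), the scanned cell, the cells right of the head.
All cells that are not listed are blank. -/
structure BitTape where
  left : List (Option Bool)
  head : Option Bool
  right : List (Option Bool)

namespace BitTape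

def blank : BitTape := ⟨[], none, []⟩

/-- The tape that holds the string `x`, with the head on its first symbol. -/
def ofString (x : List Bool) : BitTape :=
  match x with
  | [] => blank
  | b :: l => ⟨[], some b, l.map some⟩

/-- Write a symbol in the scanned cell, then move the head. -/
def update (t : BitTape) (s : Option Bool) : HeadMove → BitTape
  | .left => ⟨t.left.tail, t.left.headD none, s :: t.right⟩
  | .stay => ⟨t.left, s, t.right⟩
  | .right => ⟨s :: t.left, t.right.headD none, t.right.tail⟩

/-- The maximal blank-free string at the beginning of a list of cells. -/
def bitsOf : List (Option Bool) → List Bool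
  | some b :: l => b :: bitsOf l
  | _ => []

/-- The string held by the tape: from the scanned cell rightwards, up to the first blank. -/
def contents (t : BitTape) : List Bool := bitsOf (t.head :: t.right)

end BitTape

/-- What a machine does in one step: halt; ask the oracle; or write on every tape and move every
head.  In the last two cases it also enters a new state. -/
inductive MachineAction (State : Type) (a w : ℕ) where
  | halt
  | ask (next : State)
  | act (next : State) (write : TapeName a w → Option Bool × HeadMove)

/-- A (probabilistic) oracle Turing machine with `a` input tapes.  The transition function sees the
state, the scanned symbols, and one fresh random bit per step. -/
structure OracleTM (a : ℕ) where
  workTapes : ℕ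
  State : Type
  finiteState : Finite State
  start : State
  trans : State → (TapeName a workTapes → Option Bool) → Bool → MachineAction State a workTapes

namespace OracleTM

variable {a : ℕ}

/-- The machine does not use its random bits. -/
def IsDeterministic (M : OracleTM a) : Prop :=
  ∀ s σ, M.trans s σ true = M.trans s σ false

/-- A configuration; the state `none` means that the machine has halted. -/
structure Cfg (M : OracleTM a) where
  state : Option M.State
  tape : TapeName a M.workTapes → BitTape

def initial (M : OracleTM a) (x : Fin a → List Bool) : Cfg M where
  state := some M.start
  tape
    | .input i => BitTape.ofString (x i)
    | _ => BitTape.blank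

/-- One step with oracle `O` and random bit `coin`.  An oracle call takes one step: it reads the
query tape, erases it, and puts the answer on the answer tape. -/
def step (M : OracleTM a) (O : List Bool → List Bool) (coin : Bool) (c : Cfg M) : Cfg M :=
  match c.state with
  | none => c
  | some s =>
    match M.trans s (fun i => (c.tape i).head) coin with
    | .halt => ⟨none, c.tape⟩
    | .ask s' =>
      ⟨some s', fun
        | .query => BitTape.blank
        | .answer => BitTape.ofString (O (c.tape .query).contents)
        | i => c.tape i⟩
    | .act s' wr => ⟨some s', fun i => (c.tape i).update (wr i).1 (wr i).2⟩

/-- The configuration reached on input `x` after one step for each of the random bits `r`. -/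
def exec (M : OracleTM a) (O : List Bool → List Bool) (x : Fin a → List Bool) (r : List Bool) :
    Cfg M :=
  r.foldl (fun c coin => M.step O coin c) (M.initial x)

def result (M : OracleTM a) (O : List Bool → List Bool) (x : Fin a → List Bool) (r : List Bool) :
    List Bool :=
  ((M.exec O x r).tape .output).contents

end OracleTM

/-- A probabilistic polynomial-time oracle machine, relative to the oracles in `𝒪`: with each of
these oracles, on all inputs and for all random bits, it halts within a number of steps that is
polynomial in the total input length. -/
structure PPTMachine (a : ℕ) (𝒪 : Set (List Bool → List Bool)) where
  machine : OracleTM a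
  time : Polynomial ℕ
  halts : ∀ O ∈ 𝒪, ∀ (x : Fin a → List Bool) (r : List Bool),
    r.length = time.eval (∑ i, (x i).length) → (machine.exec O x r).state = none

/-- The distribution of the output on input `x` with oracle `O`, over uniform random bits. -/
noncomputable def PPTMachine.dist {a : ℕ} {𝒪 : Set (List Bool → List Bool)} (M : PPTMachine a 𝒪)
    (O : List Bool → List Bool) (x : Fin a → List Bool) : PMF (List Bool) :=
  (PMF.uniformOfFintype (List.Vector Bool (M.time.eval (∑ i, (x i).length)))).map
    fun r => M.machine.result O x r.toList

/-! ### Crypto oracles -/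

/-- A function `R : {0,1}* → {0,1}`, as an oracle whose answers are one bit long. -/
def bitOracle (R : List Bool → Bool) : List Bool → List Bool := fun q => [R q]

/-- A crypto oracle: a deterministic polynomial-time machine with oracle access to a function
`R : {0,1}* → {0,1}`.  It is stateless: each query to it is answered by a fresh run. -/
structure CryptoOracle where
  alg : PPTMachine 1 (Set.range bitOracle)
  deterministic : alg.machine.IsDeterministic

/-- The function `{0,1}* → {0,1}*` computed by the crypto oracle when its secret function is `R`. -/
def CryptoOracle.fn (B : CryptoOracle) (R : List Bool → Bool) (q : List Bool) : List Bool :=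
  B.alg.machine.result (bitOracle R) ![q] (List.replicate (B.alg.time.eval q.length) false)

/-- The uniformly random function `{0,1}* → {0,1}`. -/
noncomputable def randomFunction : Measure (List Bool → Bool) :=
  Measure.infinitePi fun _ => (PMF.uniformOfFintype Bool).toMeasure

/-- The probability of the event `S` in an experiment that depends on a random function. -/
noncomputable def prob {α : Type} (game : (List Bool → Bool) → PMF α) (S : Set α) : ℝ :=
  (∫⁻ R, (game R).toOuterMeasure S ∂randomFunction).toReal

/-! ### The binary symmetric channel -/

/-- The Bernoulli distribution with parameter `(1 - ρ) / 2`. -/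
noncomputable def flipBit (ρ : unitInterval) : PMF Bool :=
  PMF.ofFintype (fun b => ENNReal.ofReal (if b then (1 - ρ) / 2 else (1 + ρ) / 2)) (by
    have h0 := ρ.2.1
    have h1 := ρ.2.2
    rw [Fintype.sum_bool, ← ENNReal.ofReal_add (by simp; linarith) (by simp; linarith),
      ← ENNReal.ofReal_one]
    congr 1
    simp
    ring)

/-- The channel that flips each bit independently with probability `(1 - ρ) / 2`. -/
noncomputable def noise (ρ : unitInterval) : List Bool → PMF (List Bool)
  | [] => PMF.pure []
  | b :: x => do
    let e ← flipBit ρ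
    let y ← noise ρ x
    return (xor b e) :: y

/-! ### Private-key codes relative to a crypto oracle -/

/-- The security parameter in unary. -/
def unary (κ : ℕ) : List Bool := List.replicate κ true

/-- How the decoder's output string is read: `1m` is the message `m`; anything else is `⊥`. -/
def readMessage : List Bool → Option (List Bool)
  | true :: m => some m
  | _ => none

/-- The oracles `B^R`. -/
def CryptoOracle.oracles (B : CryptoOracle) : Set (List Bool → List Bool) := Set.range B.fn

/-- The algorithms of a binary private-key code relative to the crypto oracle `B`. -/
structure OracleCode (B : CryptoOracle) where
  keyLen : ℕ → ℕ
  msgLen : ℕ → ℕ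
  codeLen : ℕ → ℕ
  msgLen_poly : ∃ p : Polynomial ℕ, ∀ κ, msgLen κ ≤ p.eval κ
  keyGen : PPTMachine 1 B.oracles
  enc : PPTMachine 3 B.oracles
  dec : PPTMachine 3 B.oracles
  keyGen_length : ∀ O ∈ B.oracles, ∀ κ, ∀ sk ∈ (keyGen.dist O ![unary κ]).support,
    sk.length = keyLen κ
  enc_length : ∀ O ∈ B.oracles, ∀ κ (sk m : List Bool), sk.length = keyLen κ →
    m.length = msgLen κ → ∀ c ∈ (enc.dist O ![unary κ, sk, m]).support, c.length = codeLen κ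
  dec_length : ∀ O ∈ B.oracles, ∀ κ (sk c : List Bool), sk.length = keyLen κ →
    c.length = codeLen κ → ∀ y ∈ (dec.dist O ![unary κ, sk, c]).support,
      ∀ m, readMessage y = some m → m.length = msgLen κ

/-- A computationally unbounded (non-uniform, randomized, adaptive) distinguisher for messages of
length `k`, as the tree of its possible interactions with the encoding oracle and with `B^R`. -/
inductive Adversary (k : ℕ) : Type where
  | guess (b : Bool)
  | coin (next : Bool → Adversary k)
  | askEnc (m : List.Vector Bool k) (next : List Bool → Adversary k)
  | askOracle (q : List Bool) (next : List Bool → Adversary k)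

namespace Adversary

variable {k : ℕ}

/-- On every path, the number of oracle calls plus the total length of the queries to `B^R` is at
most `N`. -/
def CostAtMost : Adversary k → ℕ → Prop
  | guess _, _ => True
  | coin next, N => ∀ b, (next b).CostAtMost N
  | askEnc _ next, N => 1 ≤ N ∧ ∀ c, (next c).CostAtMost (N - 1)
  | askOracle q next, N => q.length + 1 ≤ N ∧ ∀ y, (next y).CostAtMost (N - (q.length + 1))

/-- The distribution of the guess, with encoding oracle `E` (fresh randomness in every call) and
oracle `O`. -/
noncomputable def run (E : List Bool → PMF (List Bool)) (O : List Bool → List Bool) :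
    Adversary k → PMF Bool
  | guess b => PMF.pure b
  | coin next => (PMF.uniformOfFintype Bool).bind fun b => (next b).run E O
  | askEnc m next => (E m.toList).bind fun c => (next c).run E O
  | askOracle q next => (next (O q)).run E O

end Adversary

noncomputable def uniformString (n : ℕ) : PMF (List Bool) :=
  (PMF.uniformOfFintype (List.Vector Bool n)).map List.Vector.toList

/-- Negligible functions of the security parameter. -/
def Negligible (f : ℕ → ℝ) : Prop :=
  Asymptotics.SuperpolynomialDecay atTop (fun κ : ℕ => (κ : ℝ)) f

/-- The channels `N_ρ` have a constant noise rate: `ρ = 1 - Ω(1)`. -/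
def ConstantRate (ρ : ℕ → unitInterval) : Prop :=
  ∃ c : ℝ, 0 < c ∧ ∀ᶠ κ in atTop, (ρ κ : ℝ) ≤ 1 - c

namespace OracleCode

variable {B : CryptoOracle} (C : OracleCode B)

noncomputable def sampleKey (R : List Bool → Bool) (κ : ℕ) : PMF (List Bool) :=
  C.keyGen.dist (B.fn R) ![unary κ]

noncomputable def encode (R : List Bool → Bool) (κ : ℕ) (sk m : List Bool) : PMF (List Bool) :=
  C.enc.dist (B.fn R) ![unary κ, sk, m]

/-- The decoder's output, with `none` for `⊥`. -/
noncomputable def decode (R : List Bool → Bool) (κ : ℕ) (sk c : List Bool) :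
    PMF (Option (List Bool)) :=
  (C.dec.dist (B.fn R) ![unary κ, sk, c]).map readMessage

noncomputable def completenessGame (ρ : ℕ → unitInterval) (κ : ℕ) (m : List Bool)
    (R : List Bool → Bool) : PMF (Option (List Bool)) := do
  let sk ← C.sampleKey R κ
  let c ← C.encode R κ sk m
  let c' ← noise (ρ κ) c
  C.decode R κ sk c'

noncomputable def soundnessGame (κ : ℕ) (c : List Bool) (R : List Bool → Bool) :
    PMF (Option (List Bool)) := do
  let sk ← C.sampleKey R κ
  C.decode R κ sk c

noncomputable def realGame (κ : ℕ) (A : Adversary (C.msgLen κ)) (R : List Bool → Bool) :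
    PMF Bool := do
  let sk ← C.sampleKey R κ
  A.run (C.encode R κ sk) (B.fn R)

noncomputable def idealGame (κ : ℕ) (A : Adversary (C.msgLen κ)) (R : List Bool → Bool) :
    PMF Bool :=
  A.run (fun _ => uniformString (C.codeLen κ)) (B.fn R)

/-- `δ`-completeness for the channels `N_ρ`. -/
def Complete (ρ : ℕ → unitInterval) (δ : ℕ → ℝ) : Prop :=
  ∀ (κ : ℕ) (m : List.Vector Bool (C.msgLen κ)),
    1 - δ κ ≤ prob (C.completenessGame ρ κ m.toList) {some m.toList}

/-- `μ`-soundness. -/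
def Sound (μ : ℕ → ℝ) : Prop :=
  ∀ (κ : ℕ) (c : List.Vector Bool (C.codeLen κ)),
    1 - μ κ ≤ prob (C.soundnessGame κ c.toList) {none}

noncomputable def advantage (A : (κ : ℕ) → Adversary (C.msgLen κ)) (κ : ℕ) : ℝ :=
  |prob (C.realGame κ (A κ)) {true} - prob (C.idealGame κ (A κ)) {true}|

/-- Statistical pseudorandomness relative to `B`: every computationally unbounded adversary that
makes polynomially many queries, of polynomial total length, has negligible advantage. -/
def StatPseudorandom : Prop :=
  ∀ A : (κ : ℕ) → Adversary (C.msgLen κ),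
    (∃ p : Polynomial ℕ, ∀ κ, (A κ).CostAtMost (p.eval κ)) → Negligible (C.advantage A)

/-- `C` is a statistically secure pseudorandom code for the channels `N_ρ`. -/
def IsStatPRC (ρ : ℕ → unitInterval) : Prop :=
  C.StatPseudorandom ∧ (∃ δ, Negligible δ ∧ C.Complete ρ δ) ∧ ∃ μ, Negligible μ ∧ C.Sound μ

end OracleCode

/-! An unbounded distinguisher that only asks for encodings of one fixed message is built from any
noticeable completeness–soundness gap. Since all running times are polynomial, the secret function
matters only on strings of polynomial length, so it may be treated as a random function on a finite
set, and every key, encoder or decoder run reads few of its points.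

Fix the key coins. `exists_learned` supplies a set `H` of points, of polynomial expected size, that
contains the queries of the key generation and every point that the decoder is likely to read on a
uniformly random string. Suppose the decoder is run with the function resampled outside `H`. On a
noisy encoding this changes its behaviour only if it reads a point that the encoder read and that
lies outside `H`. Either the decoder still accepts noisy encodings, whereas it rarely accepts
uniform strings by soundness; or, for some light point, the noise-averaged probability of reading it
is noticeable at the encoding. `statistic` adds the two signals, the second as a sum of squares over
all points outside `H`, so that the encoder's queries need not be known.

On uniform strings the squares are small by small-set expansion (`hypercontractive`): if a point is
read with mean probability `p`, the mean square of its noise average is at most `p ^ (1 + 1/m)`.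
Here `m` depends only on the noise rate, hence is constant for a constant rate, and `H` stays
polynomial although its threshold is an `m`-th power. Thus the mean of the statistic is larger on
encodings than on uniform strings (`exists_stopping_gap`).

The statistic depends only on the key and on the values of the function on `H`, which can be
described in polynomially many bits. The distinguisher tries all descriptions: by a Chernoff and
union bound, polynomially many samples suffice for no description to look good on uniform strings,
while the correct one does on encodings (`exists_distinguisher`). -/

open scoped BigOperators

/-! ### Hypercontractivity of the noise operator on the Boolean cube -/

theorem sum_vector_succ {n : ℕ} (f : List.Vector Bool (n + 1) → ℝ) :
    ∑ v, f v = ∑ b : Bool, ∑ v : List.Vector Bool n, f (b ::ᵥ v) := by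
  rw [← Fintype.sum_prod_type']
  refine (Fintype.sum_equiv
    ⟨fun p : Bool × List.Vector Bool n => p.1 ::ᵥ p.2, fun v => (v.head, v.tail), ?_, ?_⟩ _ _ ?_).symm
  · rintro ⟨b, v⟩
    simp
  · intro v
    simp
  · intro p
    rfl

theorem expect_vector_succ {n : ℕ} (f : List.Vector Bool (n + 1) → ℝ) :
    𝔼 v, f v = (𝔼 v : List.Vector Bool n, f (true ::ᵥ v) + 𝔼 v, f (false ::ᵥ v)) / 2 := by
  rw [Fintype.expect_eq_sum_div_card, Fintype.expect_eq_sum_div_card,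
    Fintype.expect_eq_sum_div_card, sum_vector_succ, Fintype.sum_bool]
  simp only [card_vector, Fintype.card_bool]
  push_cast
  rw [pow_succ]
  field_simp

noncomputable def flipWeight (ρ : ℝ) (a b : Bool) : ℝ := if a = b then (1 + ρ) / 2 else (1 - ρ) / 2

noncomputable def noiseWeight (ρ : ℝ) : List Bool → List Bool → ℝ
  | [], [] => 1
  | a :: c, b :: y => flipWeight ρ a b * noiseWeight ρ c y
  | _, _ => 0

theorem noiseWeight_nonneg {ρ : ℝ} (h0 : 0 ≤ ρ) (h1 : ρ ≤ 1) :
    ∀ c y : List Bool, 0 ≤ noiseWeight ρ c y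
  | [], [] => by simp [noiseWeight]
  | [], _ :: _ => by simp [noiseWeight]
  | _ :: _, [] => by simp [noiseWeight]
  | a :: c, b :: y => by
    rw [noiseWeight, flipWeight]
    have := noiseWeight_nonneg h0 h1 c y
    split_ifs <;> apply mul_nonneg <;> linarith

theorem noiseWeight_comm (ρ : ℝ) : ∀ c y : List Bool, noiseWeight ρ c y = noiseWeight ρ y c
  | [], [] => rfl
  | [], _ :: _ => rfl
  | _ :: _, [] => rfl
  | a :: c, b :: y => by
    rw [noiseWeight, noiseWeight, noiseWeight_comm ρ c y, flipWeight, flipWeight]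
    simp only [eq_comm]

/-- The noise operator: averaging of `f` over the output of the channel. -/
noncomputable def noiseOp (ρ : ℝ) {n : ℕ} (f : List.Vector Bool n → ℝ) (c : List.Vector Bool n) : ℝ :=
  ∑ y : List.Vector Bool n, noiseWeight ρ c.toList y.toList * f y

theorem noiseOp_zero (ρ : ℝ) (f : List.Vector Bool 0 → ℝ) : noiseOp ρ f = f := by
  funext c
  rw [noiseOp, Fintype.sum_subsingleton _ c, c.eq_nil]
  simp [noiseWeight]

theorem noiseOp_cons (ρ : ℝ) {n : ℕ} (f : List.Vector Bool (n + 1) → ℝ) (a : Bool)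
    (c : List.Vector Bool n) :
    noiseOp ρ f (a ::ᵥ c) = (1 + ρ) / 2 * noiseOp ρ (fun v => f (a ::ᵥ v)) c +
      (1 - ρ) / 2 * noiseOp ρ (fun v => f ((!a) ::ᵥ v)) c := by
  simp only [noiseOp, sum_vector_succ, Fintype.sum_bool, Finset.mul_sum, List.Vector.toList_cons,
    noiseWeight, flipWeight]
  cases a
  · rw [add_comm]
    simp [mul_assoc]
  · simp [mul_assoc]

theorem noiseOp_add (ρ : ℝ) {n : ℕ} (f g : List.Vector Bool n → ℝ) (c : List.Vector Bool n) :
    noiseOp ρ (fun v => f v + g v) c = noiseOp ρ f c + noiseOp ρ g c := by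
  simp [noiseOp, mul_add, Finset.sum_add_distrib]

theorem noiseOp_const_mul (ρ a : ℝ) {n : ℕ} (f : List.Vector Bool n → ℝ) (c : List.Vector Bool n) :
    noiseOp ρ (fun v => a * f v) c = a * noiseOp ρ f c := by
  simp [noiseOp, Finset.mul_sum, mul_left_comm]

theorem noiseOp_one (ρ : ℝ) : ∀ {n : ℕ} (c : List.Vector Bool n), noiseOp ρ (fun _ => 1) c = 1
  | 0, c => by rw [noiseOp_zero]
  | n + 1, c => by
    obtain ⟨a, v, rfl⟩ := c.exists_eq_cons
    rw [noiseOp_cons, noiseOp_one ρ v]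
    ring

theorem noiseOp_noiseOp (ρ : ℝ) : ∀ {n : ℕ} (f : List.Vector Bool n → ℝ) (c : List.Vector Bool n),
    noiseOp ρ (noiseOp ρ f) c = noiseOp (ρ ^ 2) f c
  | 0, f, c => by simp only [noiseOp_zero]
  | n + 1, f, c => by
    obtain ⟨a, v, rfl⟩ := c.exists_eq_cons
    rw [noiseOp_cons, noiseOp_cons]
    simp only [noiseOp_cons, noiseOp_add, noiseOp_const_mul, noiseOp_noiseOp ρ, Bool.not_not]
    ring

theorem expect_noiseOp_mul (ρ : ℝ) {n : ℕ} (f g : List.Vector Bool n → ℝ) :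
    𝔼 c, noiseOp ρ f c * g c = 𝔼 c, f c * noiseOp ρ g c := by
  simp only [noiseOp, Fintype.expect_eq_sum_div_card, Finset.sum_mul, Finset.mul_sum]
  rw [Finset.sum_comm]
  congr 1
  refine Finset.sum_congr rfl fun x _ => Finset.sum_congr rfl fun y _ => ?_
  rw [noiseWeight_comm]
  ring

theorem expect_noiseOp (ρ : ℝ) {n : ℕ} (f : List.Vector Bool n → ℝ) :
    𝔼 c, noiseOp ρ f c = 𝔼 c, f c := by
  simpa [noiseOp_one] using expect_noiseOp_mul ρ f fun _ => 1

/-- The extremal case of `two_point_inequality`: `r = 1 / 2`, `A = x ^ 6`, `B = y ^ 6`, `D = x ^ 3 *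
y ^ 3`. The polynomial in `h3` is 256 times the difference of the two sides; its double root at `x =
y` is the case of constant functions. -/
theorem two_point_polynomial {x y : ℝ} (hx : 0 ≤ x) (hy : 0 ≤ y) :
    ((5 * x ^ 6 + 6 * (x ^ 3 * y ^ 3) + 5 * y ^ 6) / 16) ^ 2 ≤ ((x ^ 4 + y ^ 4) / 2) ^ 3 := by
  have h1 : 0 ≤ 14 * x ^ 4 - 32 * (x ^ 2 * y ^ 2) + 27 * y ^ 4 := by
    nlinarith [sq_nonneg (14 * x ^ 2 - 16 * y ^ 2), sq_nonneg (y ^ 2)]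
  have h2 : 0 ≤ 14 * y ^ 4 - 32 * (x ^ 2 * y ^ 2) + 27 * x ^ 4 := by
    nlinarith [sq_nonneg (14 * y ^ 2 - 16 * x ^ 2), sq_nonneg (x ^ 2)]
  have h3 : 0 ≤ (x - y) ^ 2 * (x ^ 5 * y * (14 * x ^ 4 - 32 * (x ^ 2 * y ^ 2) + 27 * y ^ 4) +
      y ^ 5 * x * (14 * y ^ 4 - 32 * (x ^ 2 * y ^ 2) + 27 * x ^ 4) +
      (7 * x ^ 10 + 21 * (x ^ 8 * y ^ 2) + 11 * (x ^ 6 * y ^ 4) + 11 * (x ^ 4 * y ^ 6) +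
        21 * (x ^ 2 * y ^ 8) + 7 * y ^ 10)) := by positivity
  nlinarith [h3]

/-- The induction step of `expect_noiseOp_sq_sq_le`: `a`, `b` are the means of the two halves of a
function, `A`, `B` the mean squares of their noise averages, and `D` the mixed term. Fourth roots
turn the fractional exponents into a polynomial inequality. -/
theorem two_point_inequality {r a b A B D : ℝ} (hr0 : 0 ≤ r) (hr1 : r ≤ 1 / 2) (ha : 0 ≤ a)
    (hb : 0 ≤ b) (hB : 0 ≤ B) (hAa : A ^ 2 ≤ a ^ 3) (hBb : B ^ 2 ≤ b ^ 3)
    (hD : D ^ 2 ≤ A * B) (h0 : 0 ≤ (1 + r ^ 2) / 4 * (A + B) + (1 - r ^ 2) / 2 * D) :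
    ((1 + r ^ 2) / 4 * (A + B) + (1 - r ^ 2) / 2 * D) ^ 2 ≤ ((a + b) / 2) ^ 3 := by
  obtain ⟨x, hx, rfl⟩ : ∃ x : ℝ, 0 ≤ x ∧ x ^ 4 = a :=
    ⟨√√a, by positivity, by
      rw [show (4 : ℕ) = 2 * 2 from rfl, pow_mul, Real.sq_sqrt (by positivity), Real.sq_sqrt ha]⟩
  obtain ⟨y, hy, rfl⟩ : ∃ x : ℝ, 0 ≤ x ∧ x ^ 4 = b :=
    ⟨√√b, by positivity, by
      rw [show (4 : ℕ) = 2 * 2 from rfl, pow_mul, Real.sq_sqrt (by positivity), Real.sq_sqrt hb]⟩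
  have hA' : A ≤ x ^ 6 := le_of_abs_le (abs_le_of_sq_le_sq (hAa.trans_eq (by ring)) (by positivity))
  have hB' : B ≤ y ^ 6 := le_of_abs_le (abs_le_of_sq_le_sq (hBb.trans_eq (by ring)) (by positivity))
  have hD' : D ≤ x ^ 3 * y ^ 3 := by
    refine le_of_abs_le (abs_le_of_sq_le_sq (hD.trans ?_) (by positivity))
    calc A * B ≤ x ^ 6 * y ^ 6 := by gcongr
      _ = _ := by ring
  refine le_trans ?_ (two_point_polynomial hx hy)
  refine pow_le_pow_left₀ h0 ?_ 2
  have hr2 : r ^ 2 ≤ 1 / 4 := by nlinarith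
  have hr3 : 0 ≤ r ^ 2 := sq_nonneg r
  have e1 : (1 + r ^ 2) / 4 * (A + B) ≤ (1 + r ^ 2) / 4 * (x ^ 6 + y ^ 6) := by gcongr
  have e2 : (1 - r ^ 2) / 2 * D ≤ (1 - r ^ 2) / 2 * (x ^ 3 * y ^ 3) :=
    mul_le_mul_of_nonneg_left hD' (by linarith)
  -- The left side is `((x ^ 3 + y ^ 3) ^ 2 + r ^ 2 * (x ^ 3 - y ^ 3) ^ 2) / 4`, so `r = 1 / 2` is
  -- the worst case.
  have e3 : 0 ≤ (1 / 4 - r ^ 2) * (x ^ 3 - y ^ 3) ^ 2 := mul_nonneg (by linarith) (sq_nonneg _)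
  nlinarith

/-- The (4/3, 2) hypercontractive inequality, weakened by `f ^ (4/3) ≤ f` on `[0, 1]`. The weakened
form still passes through the induction on the dimension; only dimension zero needs `f ≤ 1`. -/
theorem expect_noiseOp_sq_sq_le {r : ℝ} (hr0 : 0 ≤ r) (hr1 : r ≤ 1 / 2) :
    ∀ {n : ℕ} (f : List.Vector Bool n → ℝ), (∀ c, 0 ≤ f c) → (∀ c, f c ≤ 1) →
      (𝔼 c, noiseOp r f c ^ 2) ^ 2 ≤ (𝔼 c, f c) ^ 3
  | 0, f, h0, h1 => by
    simp only [noiseOp_zero, Fintype.expect_eq_sum_div_card,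
      Fintype.sum_subsingleton _ List.Vector.nil]
    have h2 := h0 List.Vector.nil
    have h3 := h1 List.Vector.nil
    simp only [card_vector, pow_zero, Nat.cast_one, div_one]
    calc (f List.Vector.nil ^ 2) ^ 2 = f List.Vector.nil ^ 3 * f List.Vector.nil := by ring
      _ ≤ f List.Vector.nil ^ 3 * 1 := by gcongr
      _ = _ := mul_one _
  | n + 1, f, h0, h1 => by
    have iht := expect_noiseOp_sq_sq_le hr0 hr1 (fun v : List.Vector Bool n => f (true ::ᵥ v))
      (fun _ => h0 _) fun _ => h1 _
    have ihf := expect_noiseOp_sq_sq_le hr0 hr1 (fun v : List.Vector Bool n => f (false ::ᵥ v))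
      (fun _ => h0 _) fun _ => h1 _
    have key : 𝔼 c, noiseOp r f c ^ 2 =
        (1 + r ^ 2) / 4 * (𝔼 c, noiseOp r (fun v : List.Vector Bool n => f (true ::ᵥ v)) c ^ 2 +
          𝔼 c, noiseOp r (fun v : List.Vector Bool n => f (false ::ᵥ v)) c ^ 2) +
        (1 - r ^ 2) / 2 * 𝔼 c, noiseOp r (fun v : List.Vector Bool n => f (true ::ᵥ v)) c *
          noiseOp r (fun v : List.Vector Bool n => f (false ::ᵥ v)) c := by
      rw [expect_vector_succ]
      simp only [noiseOp_cons, Bool.not_true, Bool.not_false]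
      rw [← Finset.expect_add_distrib, ← Finset.expect_add_distrib, Finset.mul_expect,
        Finset.mul_expect, ← Finset.expect_add_distrib, Finset.expect_div]
      refine Finset.expect_congr rfl fun c _ => ?_
      ring
    rw [key, expect_vector_succ f]
    refine two_point_inequality hr0 hr1 (Finset.expect_nonneg fun _ _ => h0 _)
      (Finset.expect_nonneg fun _ _ => h0 _) (Finset.expect_nonneg fun _ _ => sq_nonneg _) iht ihf
      (Finset.expect_mul_sq_le_sq_mul_sq _ _ _) ?_
    rw [← key]
    exact Finset.expect_nonneg fun _ _ => sq_nonneg _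

/-- Small-set expansion of the noisy cube, with an exponent that depends on the noise rate. -/
theorem hypercontractive {r : ℝ} (j : ℕ) (hr0 : 0 ≤ r) (hr1 : r ^ 2 ^ j ≤ 1 / 2) {n : ℕ}
    (f : List.Vector Bool n → ℝ) (h0 : ∀ c, 0 ≤ f c) (h1 : ∀ c, f c ≤ 1) :
    (𝔼 c, noiseOp r f c ^ 2) ^ 2 ^ (j + 1) ≤ (𝔼 c, f c) ^ (2 ^ (j + 1) + 1) := by
  induction j generalizing r with
  | zero => simpa using expect_noiseOp_sq_sq_le hr0 (by simpa using hr1) f h0 h1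
  | succ j ih =>
    have h := ih (r := r ^ 2) (sq_nonneg r) (by rwa [← pow_mul, ← pow_succ'])
    -- The noise operator is self-adjoint and its square is the operator for `r ^ 2`. Cauchy–Schwarz
    -- therefore trades `r` for the noisier `r ^ 2`, at the price of a weaker exponent.
    have hcs : (𝔼 c, noiseOp r f c ^ 2) ^ 2 ≤ (𝔼 c, f c) * 𝔼 c, noiseOp (r ^ 2) f c ^ 2 := by
      have e : 𝔼 c, noiseOp r f c ^ 2 = 𝔼 c, f c * noiseOp (r ^ 2) f c := by
        simp only [sq (noiseOp r f _)]
        rw [expect_noiseOp_mul]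
        exact Finset.expect_congr rfl fun c _ => by rw [← noiseOp_noiseOp]
      rw [e]
      refine (Finset.expect_mul_sq_le_sq_mul_sq _ _ _).trans ?_
      refine mul_le_mul_of_nonneg_right (Finset.expect_le_expect fun c _ => ?_)
        (Finset.expect_nonneg fun _ _ => sq_nonneg _)
      have := h0 c
      have := h1 c
      nlinarith
    have hm : 0 ≤ 𝔼 c, f c := Finset.expect_nonneg fun _ _ => h0 _
    calc (𝔼 c, noiseOp r f c ^ 2) ^ 2 ^ (j + 1 + 1)
        = ((𝔼 c, noiseOp r f c ^ 2) ^ 2) ^ 2 ^ (j + 1) := by rw [← pow_mul, ← pow_succ']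
      _ ≤ ((𝔼 c, f c) * 𝔼 c, noiseOp (r ^ 2) f c ^ 2) ^ 2 ^ (j + 1) := by gcongr
      _ ≤ (𝔼 c, f c) ^ 2 ^ (j + 1) * (𝔼 c, f c) ^ (2 ^ (j + 1) + 1) := by
        rw [mul_pow]
        gcongr
      _ = _ := by
        rw [← pow_add]
        congr 1
        ring

section

variable {ρ : ℝ} {n : ℕ} (f g : List.Vector Bool n → ℝ) (c : List.Vector Bool n)

theorem noiseOp_sum {ι : Type*} (s : Finset ι) (f : ι → List.Vector Bool n → ℝ) :
    noiseOp ρ (fun v => ∑ i ∈ s, f i v) c = ∑ i ∈ s, noiseOp ρ (f i) c := by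
  simp only [noiseOp, Finset.mul_sum]
  exact Finset.sum_comm

theorem noiseOp_expect {ι : Type*} [Fintype ι] (f : ι → List.Vector Bool n → ℝ) :
    noiseOp ρ (fun v => 𝔼 i, f i v) c = 𝔼 i, noiseOp ρ (f i) c := by
  simp only [noiseOp, Finset.mul_expect]
  exact (Finset.expect_sum_comm _ _ _).symm

variable {f g}

theorem noiseOp_mono (h0 : 0 ≤ ρ) (h1 : ρ ≤ 1) (h : ∀ v, f v ≤ g v) :
    noiseOp ρ f c ≤ noiseOp ρ g c :=
  Finset.sum_le_sum fun v _ => mul_le_mul_of_nonneg_left (h v) (noiseWeight_nonneg h0 h1 _ _)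

theorem noiseOp_nonneg (h0 : 0 ≤ ρ) (h1 : ρ ≤ 1) (h : ∀ v, 0 ≤ f v) : 0 ≤ noiseOp ρ f c :=
  Finset.sum_nonneg fun v _ => mul_nonneg (noiseWeight_nonneg h0 h1 _ _) (h v)

theorem noiseOp_le_of_le {a : ℝ} (h0 : 0 ≤ ρ) (h1 : ρ ≤ 1) (h : ∀ v, f v ≤ a) :
    noiseOp ρ f c ≤ a := by
  refine (noiseOp_mono c h0 h1 (g := fun _ => a * 1) (by simpa using h)).trans_eq ?_
  rw [noiseOp_const_mul, noiseOp_one, mul_one]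

end

/-! ### Resampling a finite random function outside a stopping set -/

section Resampling

variable {X : Type} [DecidableEq X]

def patch (H : Finset X) (ω ω' : X → Bool) : X → Bool := fun x => if x ∈ H then ω x else ω' x

/-- The set `H ω` is determined by the values of `ω` on it. -/
def IsStopping (H : (X → Bool) → Finset X) : Prop :=
  ∀ ω ω', (∀ x ∈ H ω, ω x = ω' x) → H ω' = H ω

/-- The value `f ω` and the set `q ω` of the queries of a computation of `f` are determined by the
answers to the queries. -/
def IsLocal {α : Type*} (q : (X → Bool) → Finset X) (f : (X → Bool) → α) : Prop :=
  ∀ ω ω', (∀ x ∈ q ω, ω x = ω' x) → q ω' = q ω ∧ f ω' = f ω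

theorem patch_of_mem {H : Finset X} {ω ω' : X → Bool} {x : X} (h : x ∈ H) :
    patch H ω ω' x = ω x := if_pos h

theorem patch_of_notMem {H : Finset X} {ω ω' : X → Bool} {x : X} (h : x ∉ H) :
    patch H ω ω' x = ω' x := if_neg h

theorem patch_congr {H : Finset X} {ω₁ ω₂ : X → Bool} (h : ∀ x ∈ H, ω₁ x = ω₂ x)
    (ω' : X → Bool) : patch H ω₁ ω' = patch H ω₂ ω' := by
  funext x
  by_cases hx : x ∈ H <;> simp [patch, hx, h]

theorem IsStopping.apply_patch {H : (X → Bool) → Finset X} (hH : IsStopping H)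
    (ω ω' : X → Bool) : H (patch (H ω) ω ω') = H ω :=
  hH _ _ fun _ hx => (patch_of_mem hx).symm

omit [DecidableEq X] in
theorem isStopping_const (H : Finset X) : IsStopping fun _ => H := fun _ _ _ => rfl

omit [DecidableEq X] in
theorem IsLocal.isStopping {α : Type*} {q : (X → Bool) → Finset X} {f : (X → Bool) → α}
    (h : IsLocal q f) : IsStopping q := fun ω ω' hω => (h ω ω' hω).1

theorem IsLocal.apply_patch {α : Type*} {q : (X → Bool) → Finset X} {f : (X → Bool) → α}
    (h : IsLocal q f) {H : Finset X} {ω : X → Bool} (hH : q ω ⊆ H) (ω' : X → Bool) :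
    f (patch H ω ω') = f ω :=
  (h _ _ fun _ hx => (patch_of_mem (hH hx)).symm).2

variable [Fintype X]

/-- Exchanging the values of two independent functions outside `H` of the first one does not change
that set, so it is an involution of the pairs and preserves the uniform distribution. -/
theorem expect_patch {H : (X → Bool) → Finset X} (hH : IsStopping H) (f : (X → Bool) → ℝ) :
    𝔼 ω, f ω = 𝔼 ω, 𝔼 ω', f (patch (H ω) ω ω') := by
  have hinv : Function.Involutive fun p : (X → Bool) × (X → Bool) =>
      (patch (H p.1) p.1 p.2, patch (H p.1) p.2 p.1) := by
    rintro ⟨ω, ω'⟩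
    simp only [hH.apply_patch, Prod.mk.injEq]
    constructor <;> funext x <;> by_cases hx : x ∈ H ω <;> simp [patch, hx]
  calc 𝔼 ω, f ω = 𝔼 ω, 𝔼 _ω' : X → Bool, f ω := by simp
    _ = 𝔼 p : (X → Bool) × (X → Bool), f p.1 := by
      rw [← Finset.univ_product_univ, Finset.expect_product]
    _ = 𝔼 p : (X → Bool) × (X → Bool), f (patch (H p.1) p.1 p.2) :=
      (Fintype.expect_equiv hinv.toPerm _ _ fun _ => rfl).symm
    _ = _ := by rw [← Finset.univ_product_univ, Finset.expect_product]

end Resampling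

/-! ### Codes relative to a finite random function -/

/-- The algorithms of a code with codeword length `n` relative to a random function on the finite
set `X`; `Kr`, `Er`, `Dr` are the random coins of the key generation, the encoder for a fixed
message, and the decoder, which accepts when it outputs that message. -/
structure FiniteCode (X K Kr Er Dr : Type) [DecidableEq X] (n : ℕ) where
  key : Kr → (X → Bool) → K
  keyQ : Kr → (X → Bool) → Finset X
  key_local : ∀ r, IsLocal (keyQ r) (key r)
  enc : K → Er → (X → Bool) → List.Vector Bool n
  encQ : K → Er → (X → Bool) → Finset X
  enc_local : ∀ k e, IsLocal (encQ k e) (enc k e)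
  dec : K → Dr → List.Vector Bool n → (X → Bool) → Bool
  decQ : K → Dr → List.Vector Bool n → (X → Bool) → Finset X
  dec_local : ∀ k d y, IsLocal (decQ k d y) (dec k d y)
  queries : ℕ
  keyQ_card : ∀ r ω, (keyQ r ω).card ≤ queries
  encQ_card : ∀ k e ω, (encQ k e ω).card ≤ queries
  decQ_card : ∀ k d y ω, (decQ k d y ω).card ≤ queries

namespace FiniteCode

variable {X K Kr Er Dr : Type} [DecidableEq X] [Fintype X] [Fintype Dr] {n : ℕ} (S : FiniteCode X K Kr Er Dr n)

/-- The probability that the decoder queries `x` when the function is resampled outside `H`. -/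
noncomputable def hitProb (k : K) (H : Finset X) (ω : X → Bool) (x : X)
    (y : List.Vector Bool n) : ℝ :=
  𝔼 ω', 𝔼 d, if x ∈ S.decQ k d y (patch H ω ω') then 1 else 0

/-- The probability that the decoder accepts when the function is resampled outside `H`. -/
noncomputable def accProb (k : K) (H : Finset X) (ω : X → Bool) (y : List.Vector Bool n) : ℝ :=
  𝔼 ω', 𝔼 d, if S.dec k d y (patch H ω ω') then 1 else 0

/-- The statistic by which encodings are told from uniform strings, for a key `k` and the part of
the random function on `H`. -/
noncomputable def statistic (ρ ε : ℝ) (k : K) (H : Finset X) (ω : X → Bool)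
    (c : List.Vector Bool n) : ℝ :=
  noiseOp ρ (S.accProb k H ω) c + (∑ x ∈ Hᶜ, noiseOp ρ (S.hitProb k H ω x) c ^ 2) / ε

theorem hitProb_nonneg (k : K) (H : Finset X) (ω : X → Bool) (x : X) (y : List.Vector Bool n) :
    0 ≤ S.hitProb k H ω x y :=
  Finset.expect_nonneg fun _ _ => Finset.expect_nonneg fun _ _ => by split_ifs <;> norm_num

theorem hitProb_le_one [Nonempty Dr] (k : K) (H : Finset X) (ω : X → Bool) (x : X) (y : List.Vector Bool n) :
    S.hitProb k H ω x y ≤ 1 :=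
  Finset.expect_le Finset.univ_nonempty fun _ _ =>
    Finset.expect_le Finset.univ_nonempty fun _ _ => by split_ifs <;> norm_num

theorem accProb_nonneg (k : K) (H : Finset X) (ω : X → Bool) (y : List.Vector Bool n) :
    0 ≤ S.accProb k H ω y :=
  Finset.expect_nonneg fun _ _ => Finset.expect_nonneg fun _ _ => by split_ifs <;> norm_num

theorem accProb_le_one [Nonempty Dr] (k : K) (H : Finset X) (ω : X → Bool) (y : List.Vector Bool n) :
    S.accProb k H ω y ≤ 1 :=
  Finset.expect_le Finset.univ_nonempty fun _ _ =>
    Finset.expect_le Finset.univ_nonempty fun _ _ => by split_ifs <;> norm_num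

variable [Nonempty Dr]

theorem sum_hitProb_le (k : K) (H s : Finset X) (ω : X → Bool) (y : List.Vector Bool n) :
    ∑ x ∈ s, S.hitProb k H ω x y ≤ S.queries := by
  simp only [hitProb]
  rw [← Finset.expect_sum_comm]
  refine Finset.expect_le Finset.univ_nonempty fun ω' _ => ?_
  rw [← Finset.expect_sum_comm]
  refine Finset.expect_le Finset.univ_nonempty fun d _ => ?_
  rw [Finset.sum_boole]
  refine Nat.cast_le.2 ((Finset.card_le_card fun x hx => ?_).trans
    (S.decQ_card k d y (patch H ω ω')))
  exact (Finset.mem_filter.1 hx).2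

variable {ρ ε : ℝ}

omit [Nonempty Dr] in
theorem statistic_nonneg (h0 : 0 ≤ ρ) (h1 : ρ ≤ 1) (hε : 0 < ε) (k : K) (H : Finset X)
    (ω : X → Bool) (c : List.Vector Bool n) : 0 ≤ S.statistic ρ ε k H ω c :=
  add_nonneg (noiseOp_nonneg _ h0 h1 fun _ => S.accProb_nonneg _ _ _ _)
    (div_nonneg (Finset.sum_nonneg fun _ _ => sq_nonneg _) hε.le)

/-- The squares are at most the probabilities themselves, and those sum to at most the number of
decoder queries. The bound makes the Chernoff estimate applicable. -/
theorem statistic_le (h0 : 0 ≤ ρ) (h1 : ρ ≤ 1) (hε : 0 < ε) (k : K) (H : Finset X)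
    (ω : X → Bool) (c : List.Vector Bool n) : S.statistic ρ ε k H ω c ≤ 1 + S.queries / ε := by
  refine add_le_add (noiseOp_le_of_le _ h0 h1 fun _ => S.accProb_le_one _ _ _ _) ?_
  gcongr
  calc ∑ x ∈ Hᶜ, noiseOp ρ (S.hitProb k H ω x) c ^ 2
      ≤ ∑ x ∈ Hᶜ, noiseOp ρ (S.hitProb k H ω x) c := by
        refine Finset.sum_le_sum fun x _ => ?_
        have ha := noiseOp_nonneg c h0 h1 (S.hitProb_nonneg k H ω x)
        have hb := noiseOp_le_of_le c h0 h1 (S.hitProb_le_one k H ω x)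
        nlinarith
    _ = noiseOp ρ (fun y => ∑ x ∈ Hᶜ, S.hitProb k H ω x y) c := (noiseOp_sum _ _ _).symm
    _ ≤ S.queries := noiseOp_le_of_le _ h0 h1 (S.sum_hitProb_le k H Hᶜ ω)

/-- There is a stopping set of small expected size that contains the queries of the key generation
and all queries that the decoder is likely to make on a uniformly random string. -/
theorem exists_learned (r : Kr) {τ : ℝ} (hτ : 0 < τ) :
    ∃ H : (X → Bool) → Finset X, IsStopping H ∧ (∀ ω, S.keyQ r ω ⊆ H ω) ∧
      𝔼 ω, ((H ω).card : ℝ) ≤ S.queries + S.queries / τ ∧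
      ∀ ω, ∀ x ∉ H ω, 𝔼 y, S.hitProb (S.key r ω) (H ω) ω x y ≤ τ := by
  classical
  -- Each point of the set costs `τ` and earns the probability that the decoder reads it. A
  -- maximiser over the finitely many admissible stopping sets is small, by comparison with `keyQ`,
  -- and omits no profitable point.
  let Φ : ((X → Bool) → Finset X) → ℝ := fun H => 𝔼 ω,
    (𝔼 y, 𝔼 d, ((S.decQ (S.key r ω) d y ω ∩ H ω).card : ℝ) - τ * (H ω).card)
  obtain ⟨H, ⟨hH, hkey⟩, hmax⟩ := Set.exists_max_image
    {H : (X → Bool) → Finset X | IsStopping H ∧ ∀ ω, S.keyQ r ω ⊆ H ω} Φ (Set.toFinite _)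
    ⟨S.keyQ r, (S.key_local r).isStopping, fun _ => subset_rfl⟩
  refine ⟨H, hH, hkey, ?_, ?_⟩
  · have h := hmax (S.keyQ r) ⟨(S.key_local r).isStopping, fun _ => subset_rfl⟩
    have hlow : -(τ * S.queries) ≤ Φ (S.keyQ r) := by
      refine Finset.le_expect Finset.univ_nonempty fun ω _ => ?_
      have h1 : 0 ≤ 𝔼 y, 𝔼 d, ((S.decQ (S.key r ω) d y ω ∩ S.keyQ r ω).card : ℝ) :=
        Finset.expect_nonneg fun _ _ => Finset.expect_nonneg fun _ _ => Nat.cast_nonneg _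
      have h2 : τ * (S.keyQ r ω).card ≤ τ * S.queries :=
        mul_le_mul_of_nonneg_left (Nat.cast_le.2 (S.keyQ_card r ω)) hτ.le
      linarith
    have hup : Φ H ≤ S.queries - τ * 𝔼 ω, ((H ω).card : ℝ) := by
      simp only [Φ]
      rw [Finset.expect_sub_distrib, Finset.mul_expect]
      gcongr
      refine Finset.expect_le Finset.univ_nonempty fun ω _ =>
        Finset.expect_le Finset.univ_nonempty fun y _ =>
        Finset.expect_le Finset.univ_nonempty fun d _ => Nat.cast_le.2 ?_
      exact (Finset.card_le_card Finset.inter_subset_left).trans (S.decQ_card _ _ _ _)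
    have h3 : τ * 𝔼 ω, ((H ω).card : ℝ) ≤ τ * (S.queries + S.queries / τ) := by
      rw [mul_add, mul_div_cancel₀ _ hτ.ne']
      linarith
    exact le_of_mul_le_mul_left h3 hτ
  · intro ω₀ x₀ hx₀
    by_contra! hlt
    let agree : (X → Bool) → Prop := fun ω => ∀ x ∈ H ω₀, ω x = ω₀ x
    have hagree : ∀ ω, agree ω → H ω = H ω₀ := fun ω h => hH ω₀ ω fun x hx => (h x hx).symm
    -- A heavy point that is left out at `ω₀` is added at all functions with the same values on `H
    -- ω₀`. The set remains a stopping set, and `Φ` grows, contrary to maximality.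
    let H' : (X → Bool) → Finset X := fun ω => if agree ω then insert x₀ (H ω) else H ω
    have hsub : ∀ ω, H ω ⊆ H' ω := fun ω => by
      simp only [H']
      split_ifs
      · exact Finset.subset_insert _ _
      · exact subset_rfl
    have hH' : IsStopping H' := by
      intro ω ω' h
      have e : H ω' = H ω := hH ω ω' fun x hx => h x (hsub ω hx)
      have e2 : agree ω' ↔ agree ω := by
        constructor
        · intro h1 x hx
          rw [h x (hsub ω (by rwa [← e, hagree _ h1])), h1 x hx]
        · intro h1 x hx
          rw [← h x (hsub ω (by rwa [hagree _ h1])), h1 x hx]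
      simp only [H', e, e2]
    have hle := hmax H' ⟨hH', fun ω => (hkey ω).trans (hsub ω)⟩
    let G : (X → Bool) → ℝ := fun ω =>
      𝔼 y, 𝔼 d, if x₀ ∈ S.decQ (S.key r ω) d y ω then 1 else 0
    have hdiff : Φ H' - Φ H = 𝔼 ω, (if agree ω then 1 else 0) * (G ω - τ) := by
      simp only [Φ]
      rw [← Finset.expect_sub_distrib]
      refine Finset.expect_congr rfl fun ω _ => ?_
      by_cases ha : agree ω
      · have hx : x₀ ∉ H ω := by rwa [hagree _ ha]
        have e : ∀ s : Finset X, ((s ∩ insert x₀ (H ω)).card : ℝ) =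
            (s ∩ H ω).card + if x₀ ∈ s then 1 else 0 := by
          intro s
          split_ifs with hs
          · rw [Finset.inter_insert_of_mem hs, Finset.card_insert_of_notMem (by simp [hx])]
            push_cast
            ring
          · rw [Finset.inter_insert_of_notMem hs]
            simp
        simp only [H', if_pos ha, e, Finset.card_insert_of_notMem hx, G,
          Finset.expect_add_distrib]
        push_cast
        ring
      · simp [H', if_neg ha]
    -- Given agreement with `ω₀` on `H ω₀`, the function is uniform elsewhere and the key is fixed,
    -- so the conditional reading probability is `hitProb`.
    have hG : 𝔼 ω, (if agree ω then 1 else 0) * (G ω - τ) =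
        (𝔼 ω, if agree ω then (1 : ℝ) else 0) *
          (𝔼 y, S.hitProb (S.key r ω₀) (H ω₀) ω₀ x₀ y - τ) := by
      rw [expect_patch (isStopping_const (H ω₀)), Finset.expect_mul]
      refine Finset.expect_congr rfl fun ω _ => ?_
      have hpa : ∀ ω', agree (patch (H ω₀) ω ω') ↔ agree ω := fun ω' =>
        forall₂_congr fun x hx => by rw [patch_of_mem hx]
      by_cases ha : agree ω
      · have hp : ∀ ω', patch (H ω₀) ω ω' = patch (H ω₀) ω₀ ω' := patch_congr ha
        simp only [hpa]
        simp only [if_pos ha, hp, one_mul, G, (S.key_local r).apply_patch (hkey ω₀)]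
        rw [Finset.expect_sub_distrib, Finset.expect_comm, Fintype.expect_const]
        rfl
      · simp [hpa, ha]
    have hpos : 0 < 𝔼 ω, if agree ω then (1 : ℝ) else 0 :=
      Finset.expect_pos' (fun _ _ => by split_ifs <;> norm_num)
        ⟨ω₀, Finset.mem_univ _, by simp [agree]⟩
    have := mul_pos hpos (sub_pos.2 hlt)
    rw [← hG, ← hdiff] at this
    linarith

variable {H : (X → Bool) → Finset X} {r : Kr}

omit [Nonempty Dr] in
-- Resampling outside `H` preserves both the key and the distribution of the function, so soundness
-- controls the mean of `accProb` on uniform strings.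
theorem expect_accProb (hH : IsStopping H) (hkey : ∀ ω, S.keyQ r ω ⊆ H ω) :
    𝔼 ω, 𝔼 y, S.accProb (S.key r ω) (H ω) ω y =
      𝔼 ω, 𝔼 y, 𝔼 d, if S.dec (S.key r ω) d y ω then (1 : ℝ) else 0 := by
  rw [expect_patch hH fun ω => 𝔼 y, 𝔼 d, if S.dec (S.key r ω) d y ω then (1 : ℝ) else 0]
  refine Finset.expect_congr rfl fun ω _ => ?_
  simp only [(S.key_local r).apply_patch (hkey ω)]
  rw [Finset.expect_comm]
  rfl

omit [Fintype X] [Fintype Dr] [Nonempty Dr] in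
-- The two patched functions differ only on `Q \ H`; the decoder cannot notice unless it reads a
-- point there.
theorem dec_patch_union_le (k : K) (d : Dr) (y : List.Vector Bool n) (H Q : Finset X)
    (ω ω' : X → Bool) :
    (if S.dec k d y (patch (H ∪ Q) ω ω') then (1 : ℝ) else 0) ≤
      (if S.dec k d y (patch H ω ω') then 1 else 0) +
        ∑ x ∈ Q \ H, if x ∈ S.decQ k d y (patch H ω ω') then 1 else 0 := by
  by_cases h : ∃ x ∈ Q \ H, x ∈ S.decQ k d y (patch H ω ω')
  · obtain ⟨x, hx, hxd⟩ := h
    have h1 : (1 : ℝ) ≤ ∑ x ∈ Q \ H, if x ∈ S.decQ k d y (patch H ω ω') then 1 else 0 := by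
      refine le_trans ?_ (Finset.single_le_sum (fun z _ => ?_) hx)
      · rw [if_pos hxd]
      · split_ifs <;> norm_num
    have h2 : (0 : ℝ) ≤ if S.dec k d y (patch H ω ω') then 1 else 0 := by
      split_ifs <;> norm_num
    have h3 : (if S.dec k d y (patch (H ∪ Q) ω ω') then (1 : ℝ) else 0) ≤ 1 := by
      split_ifs <;> norm_num
    linarith
  · push Not at h
    rw [(S.dec_local k d y (patch H ω ω') (patch (H ∪ Q) ω ω') fun x hx => ?_).2]
    · exact le_add_of_nonneg_right (Finset.sum_nonneg fun z _ => by split_ifs <;> norm_num)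
    · by_cases hxH : x ∈ H
      · rw [patch_of_mem hxH, patch_of_mem (Finset.mem_union_left _ hxH)]
      · have hxQ : x ∉ Q := fun hxQ => h x (Finset.mem_sdiff.2 ⟨hxQ, hxH⟩) hx
        rw [patch_of_notMem hxH, patch_of_notMem (by simp [hxH, hxQ])]

omit [Nonempty Dr] in
-- For fixed encoder coins, resampling outside `H` and the encoder's queries keeps key and codeword.
-- Resampling the encoder's queries as well costs the probability that the decoder reads one of them
-- outside `H`.
theorem expect_dec_le [Fintype Er] [Nonempty Er] (h0 : 0 ≤ ρ) (h1 : ρ ≤ 1) (hε : 0 < ε) (hH : IsStopping H)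
    (hkey : ∀ ω, S.keyQ r ω ⊆ H ω) :
    𝔼 ω, 𝔼 e, noiseOp ρ (fun y => 𝔼 d, if S.dec (S.key r ω) d y ω then (1 : ℝ) else 0)
        (S.enc (S.key r ω) e ω) ≤
      𝔼 ω, 𝔼 e, S.statistic ρ ε (S.key r ω) (H ω) ω (S.enc (S.key r ω) e ω) +
        S.queries * ε := by
  rw [Finset.expect_comm, Finset.expect_comm _ _ fun ω e => S.statistic ρ ε (S.key r ω) (H ω) ω _,
    ← Fintype.expect_const (ι := Er) (S.queries * ε), ← Finset.expect_add_distrib]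
  refine Finset.expect_le_expect fun e _ => ?_
  have hunion : IsStopping fun ω => H ω ∪ S.encQ (S.key r ω) e ω := by
    intro ω ω' h
    have e1 : H ω' = H ω := hH ω ω' fun x hx => h x (Finset.mem_union_left _ hx)
    have e2 : S.key r ω' = S.key r ω :=
      (S.key_local r ω ω' fun x hx => h x (Finset.mem_union_left _ (hkey ω hx))).2
    simp only [e1, e2]
    rw [(S.enc_local (S.key r ω) e ω ω' fun x hx => h x (Finset.mem_union_right _ hx)).1]
  rw [expect_patch hunion, ← Fintype.expect_const (ι := X → Bool) (S.queries * ε),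
    ← Finset.expect_add_distrib]
  refine Finset.expect_le_expect fun ω _ => ?_
  have e1 : ∀ ω', S.key r (patch (H ω ∪ S.encQ (S.key r ω) e ω) ω ω') = S.key r ω := fun ω' =>
    (S.key_local r).apply_patch ((hkey ω).trans Finset.subset_union_left) ω'
  have e2 : ∀ ω', S.enc (S.key r ω) e (patch (H ω ∪ S.encQ (S.key r ω) e ω) ω ω') =
      S.enc (S.key r ω) e ω := fun ω' =>
    (S.enc_local (S.key r ω) e).apply_patch Finset.subset_union_right ω'
  simp only [e1, e2]
  generalize S.key r ω = k
  generalize S.enc k e ω = c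
  rw [← noiseOp_expect]
  have hstep : ∀ y, (𝔼 ω', 𝔼 d, if S.dec k d y (patch (H ω ∪ S.encQ k e ω) ω ω') then (1 : ℝ)
      else 0) ≤ S.accProb k (H ω) ω y + ∑ x ∈ S.encQ k e ω \ H ω, S.hitProb k (H ω) ω x y := by
    intro y
    simp only [accProb, hitProb]
    rw [← Finset.expect_sum_comm, ← Finset.expect_add_distrib]
    refine Finset.expect_le_expect fun ω' _ => ?_
    rw [← Finset.expect_sum_comm, ← Finset.expect_add_distrib]
    exact Finset.expect_le_expect fun d _ => S.dec_patch_union_le k d y _ _ ω ω'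
  refine (noiseOp_mono c h0 h1 hstep).trans ?_
  rw [noiseOp_add, noiseOp_sum, statistic, add_assoc]
  gcongr
  -- By `t ≤ t ^ 2 / ε + ε`, the unknown set of encoder queries enters only through its cardinality,
  -- and the squares can be summed over the whole complement of `H`.
  calc ∑ x ∈ S.encQ k e ω \ H ω, noiseOp ρ (S.hitProb k (H ω) ω x) c
      ≤ ∑ x ∈ S.encQ k e ω \ H ω, (noiseOp ρ (S.hitProb k (H ω) ω x) c ^ 2 / ε + ε) := by
        refine Finset.sum_le_sum fun x _ => ?_
        generalize noiseOp ρ (S.hitProb k (H ω) ω x) c = t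
        rw [← sub_nonneg, show t ^ 2 / ε + ε - t = ((t - ε) ^ 2 + t * ε) / ε by field_simp; ring]
        by_cases ht : 0 ≤ t
        · positivity
        · have : 0 ≤ (t - ε) ^ 2 + t * ε := by nlinarith [sq_nonneg (t - ε / 2), sq_nonneg ε]
          positivity
    _ ≤ (∑ x ∈ (H ω)ᶜ, noiseOp ρ (S.hitProb k (H ω) ω x) c ^ 2) / ε + S.queries * ε := by
        rw [Finset.sum_add_distrib, Finset.sum_const, nsmul_eq_mul, ← Finset.sum_div]
        gcongr
        · exact fun x hx => Finset.mem_compl.2 (Finset.mem_sdiff.1 hx).2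
        · exact (Finset.card_le_card Finset.sdiff_subset).trans (S.encQ_card _ _ _)

/-- For a light point with mean reading probability `p ≤ t ^ m`, small-set expansion bounds the mean
square by `p ^ (1 + 1/m) ≤ p * t`, and the `p` sum to at most `queries`. -/
theorem expect_statistic_le (hε : 0 < ε) {m : ℕ} (hm : m ≠ 0) {t : ℝ}
    (ht : 0 ≤ t)
    (hyp : ∀ f : List.Vector Bool n → ℝ, (∀ c, 0 ≤ f c) → (∀ c, f c ≤ 1) →
      (𝔼 c, noiseOp ρ f c ^ 2) ^ m ≤ (𝔼 c, f c) ^ (m + 1))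
    (k : K) (H : Finset X) (ω : X → Bool)
    (hlight : ∀ x ∉ H, 𝔼 y, S.hitProb k H ω x y ≤ t ^ m) :
    𝔼 c, S.statistic ρ ε k H ω c ≤ 𝔼 y, S.accProb k H ω y + S.queries * t / ε := by
  simp only [statistic]
  rw [Finset.expect_add_distrib, expect_noiseOp, ← Finset.expect_div, Finset.expect_sum_comm]
  gcongr
  calc ∑ x ∈ Hᶜ, 𝔼 c, noiseOp ρ (S.hitProb k H ω x) c ^ 2
      ≤ ∑ x ∈ Hᶜ, (𝔼 y, S.hitProb k H ω x y) * t := by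
        refine Finset.sum_le_sum fun x hx => ?_
        have hn : 0 ≤ 𝔼 y, S.hitProb k H ω x y :=
          Finset.expect_nonneg fun _ _ => S.hitProb_nonneg _ _ _ _ _
        refine le_of_pow_le_pow_left₀ hm (mul_nonneg hn ht) ?_
        refine (hyp _ (S.hitProb_nonneg k H ω x) (S.hitProb_le_one k H ω x)).trans ?_
        rw [pow_succ, mul_pow]
        gcongr
        exact hlight x (Finset.mem_compl.1 hx)
    _ = (𝔼 y, ∑ x ∈ Hᶜ, S.hitProb k H ω x y) * t := by
        rw [Finset.expect_sum_comm, Finset.sum_mul]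
    _ ≤ S.queries * t := by
        gcongr
        exact Finset.expect_le Finset.univ_nonempty fun y _ => S.sum_hitProb_le k H _ ω y

end FiniteCode

/-! ### Statistical tests on independent samples -/

/-- The expectation of `g` on the list `l` extended by `p` independent samples. -/
noncomputable def sampleExpect {I Y : Type} [Fintype I] (s : I → Y) (g : List Y → ℝ) :
    ℕ → List Y → ℝ
  | 0, l => g l
  | p + 1, l => 𝔼 i, sampleExpect s g p (s i :: l)

section Samples

variable {I Y : Type} [Fintype I] (s : I → Y)

theorem sampleExpect_mono {g g' : List Y → ℝ} :
    ∀ (p : ℕ) (l : List Y), (∀ l' : List Y, l'.length = p + l.length → g l' ≤ g' l') →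
      sampleExpect s g p l ≤ sampleExpect s g' p l
  | 0, l, h => h l (by simp)
  | p + 1, l, h => Finset.expect_le_expect fun i _ =>
      sampleExpect_mono p _ fun l' hl' => h l' (by simp only [hl', List.length_cons]; omega)

theorem sampleExpect_const [Nonempty I] (a : ℝ) :
    ∀ (p : ℕ) (l : List Y), sampleExpect s (fun _ => a) p l = a
  | 0, _ => rfl
  | p + 1, l => by simp [sampleExpect, sampleExpect_const a p]

theorem sampleExpect_add (g g' : List Y → ℝ) :
    ∀ (p : ℕ) (l : List Y), sampleExpect s (fun l => g l + g' l) p l =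
      sampleExpect s g p l + sampleExpect s g' p l
  | 0, _ => rfl
  | p + 1, l => by simp [sampleExpect, sampleExpect_add g g' p, Finset.expect_add_distrib]

theorem sampleExpect_sum {ι : Type} (t : Finset ι) (g : ι → List Y → ℝ) :
    ∀ (p : ℕ) (l : List Y), sampleExpect s (fun l => ∑ j ∈ t, g j l) p l =
      ∑ j ∈ t, sampleExpect s (g j) p l
  | 0, _ => rfl
  | p + 1, l => by simp [sampleExpect, sampleExpect_sum t g p, Finset.expect_sum_comm]

theorem sampleExpect_exp_mul (f : Y → ℝ) (b a : ℝ) :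
    ∀ (p : ℕ) (l : List Y), sampleExpect s (fun l => Real.exp (a * (l.map f).sum - b)) p l =
      (𝔼 i, Real.exp (a * f (s i))) ^ p * Real.exp (a * (l.map f).sum - b)
  | 0, l => by simp [sampleExpect]
  | p + 1, l => by
    simp only [sampleExpect, sampleExpect_exp_mul f b a p, List.map_cons, List.sum_cons]
    rw [← Finset.mul_expect, pow_succ, mul_assoc, Finset.expect_mul]
    congr 1
    refine Finset.expect_congr rfl fun i _ => ?_
    rw [← Real.exp_add]
    congr 1
    ring

/-- A Chernoff bound. -/
theorem sampleExpect_tail_le [Nonempty I] {f : Y → ℝ} (hf : ∀ i, |f (s i)| ≤ 1)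
    (hf0 : 𝔼 i, f (s i) = 0) {α : ℝ} (h0 : 0 ≤ α) (h1 : α ≤ 1) (p : ℕ) :
    sampleExpect s (fun l => if p * α ≤ (l.map f).sum then 1 else 0) p [] ≤
      Real.exp (-(p * α ^ 2 / 4)) := by
  -- From `exp x ≤ 1 + x + x ^ 2` for `|x| ≤ 1`; the linear term has mean zero.
  have hexp : 𝔼 i, Real.exp (α / 2 * f (s i)) ≤ Real.exp (α ^ 2 / 4) := by
    calc 𝔼 i, Real.exp (α / 2 * f (s i)) ≤ 𝔼 i, (1 + α ^ 2 / 4 + α / 2 * f (s i)) := by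
          refine Finset.expect_le_expect fun i _ => ?_
          have hi := abs_le.1 (hf i)
          have hx : |α / 2 * f (s i)| ≤ 1 := by
            rw [abs_mul, abs_of_nonneg (by linarith)]
            nlinarith [hf i, abs_nonneg (f (s i))]
          have h2 := (abs_le.1 (Real.abs_exp_sub_one_sub_id_le hx)).2
          have h3 : f (s i) ^ 2 ≤ 1 := by nlinarith
          nlinarith [sq_nonneg α]
      _ = 1 + α ^ 2 / 4 := by
          rw [Finset.expect_add_distrib, ← Finset.mul_expect, hf0, Fintype.expect_const]
          ring
      _ ≤ Real.exp (α ^ 2 / 4) := by linarith [Real.add_one_le_exp (α ^ 2 / 4)]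
  calc sampleExpect s (fun l => if p * α ≤ (l.map f).sum then 1 else 0) p []
      ≤ sampleExpect s (fun l => Real.exp (α / 2 * (l.map f).sum - α / 2 * (p * α))) p [] := by
        refine sampleExpect_mono s p [] fun l _ => ?_
        split_ifs with h
        · rw [← mul_sub]
          exact Real.one_le_exp (mul_nonneg (by linarith) (by linarith))
        · positivity
    _ ≤ Real.exp (α ^ 2 / 4) ^ p * Real.exp (-(α / 2 * (p * α))) := by
        rw [sampleExpect_exp_mul]
        simp only [List.map_nil, List.sum_nil, mul_zero, zero_sub]
        gcongr
    _ = _ := by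
        rw [← Real.exp_nat_mul, ← Real.exp_add]
        congr 1
        ring

end Samples

section Tests

variable {Y Θ : Type} [Fintype Y] [Nonempty Y] [Fintype Θ]

/-- One of the statistics `F θ` has a larger mean on the `p` samples in the list than on the uniform
distribution. -/
def exceeds (F : Θ → Y → ℝ) (α : ℝ) (p : ℕ) (l : List Y) : Prop :=
  ∃ θ, p * α ≤ (l.map fun c => F θ c - 𝔼 v, F θ v).sum

variable {F : Θ → Y → ℝ} {α : ℝ} {p : ℕ}

open Classical in
theorem sampleExpect_exceeds_le (hF0 : ∀ θ c, 0 ≤ F θ c) (hF1 : ∀ θ c, F θ c ≤ 1) (h0 : 0 ≤ α)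
    (h1 : α ≤ 1) :
    sampleExpect (fun v : Y => v) (fun l => if exceeds F α p l then 1 else 0) p [] ≤
      Fintype.card Θ * Real.exp (-(p * α ^ 2 / 4)) := by
  calc _ ≤ sampleExpect (fun v : Y => v)
        (fun l => ∑ θ, if p * α ≤ (l.map fun c => F θ c - 𝔼 v, F θ v).sum then 1 else 0) p [] := by
        refine sampleExpect_mono _ _ _ fun l _ => ?_
        have hn : ∀ θ : Θ, (0 : ℝ) ≤
            if p * α ≤ (l.map fun c => F θ c - 𝔼 v, F θ v).sum then 1 else 0 := fun θ => by
          split_ifs <;> norm_num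
        split_ifs with h
        · obtain ⟨θ, hθ⟩ := h
          refine le_trans ?_ (Finset.single_le_sum (fun θ _ => hn θ) (Finset.mem_univ θ))
          rw [if_pos hθ]
        · exact Finset.sum_nonneg fun θ _ => hn θ
    _ = ∑ θ, sampleExpect (fun v : Y => v) (fun l =>
          if p * α ≤ (l.map fun c => F θ c - 𝔼 v, F θ v).sum then 1 else 0) p [] :=
        sampleExpect_sum _ _ _ _ _
    _ ≤ ∑ _θ : Θ, Real.exp (-(p * α ^ 2 / 4)) := by
        refine Finset.sum_le_sum fun θ _ => sampleExpect_tail_le _ (fun v => ?_) ?_ h0 h1 p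
        · have e0 : 0 ≤ 𝔼 v, F θ v := Finset.expect_nonneg fun v _ => hF0 θ v
          have e1 : 𝔼 v, F θ v ≤ 1 := Finset.expect_le Finset.univ_nonempty fun v _ => hF1 θ v
          have e2 := hF0 θ v
          have e3 := hF1 θ v
          rw [abs_le]
          constructor <;> linarith
        · rw [Finset.expect_sub_distrib, Fintype.expect_const, sub_self]
    _ = _ := by simp

omit [Nonempty Y] [Fintype Θ] in
open Classical in
-- With a mean gap of `2 * α`, the test for `θ` can fail only if the empirical mean falls `α` below
-- its expectation, which is a Chernoff event for the negated statistic.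
theorem le_sampleExpect_exceeds {I : Type} [Fintype I] [Nonempty I] (s : I → Y)
    (hF0 : ∀ θ c, 0 ≤ F θ c) (hF1 : ∀ θ c, F θ c ≤ 1) (h0 : 0 ≤ α) (h1 : α ≤ 1) (θ : Θ)
    (hθ : 2 * α ≤ 𝔼 i, F θ (s i) - 𝔼 v, F θ v) :
    1 - Real.exp (-(p * α ^ 2 / 4)) ≤
      sampleExpect s (fun l => if exceeds F α p l then 1 else 0) p [] := by
  have hsum : ∀ (l : List Y) (a b : ℝ), (l.map fun c => a - F θ c).sum =
      l.length * (a - b) - (l.map fun c => F θ c - b).sum := by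
    intro l a b
    induction l with
    | nil => simp
    | cons c l ih =>
      simp only [List.map_cons, List.sum_cons, ih, List.length_cons]
      push_cast
      ring
  have htail := sampleExpect_tail_le s (f := fun c => 𝔼 i, F θ (s i) - F θ c) (fun j => by
      have e0 : 0 ≤ 𝔼 i, F θ (s i) := Finset.expect_nonneg fun i _ => hF0 θ _
      have e1 : 𝔼 i, F θ (s i) ≤ 1 := Finset.expect_le Finset.univ_nonempty fun i _ => hF1 θ _
      have e2 := hF0 θ (s j)
      have e3 := hF1 θ (s j)
      rw [abs_le]
      constructor <;> linarith)
    (by rw [Finset.expect_sub_distrib, Fintype.expect_const, sub_self]) h0 h1 p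
  have hone : (1 : ℝ) ≤ sampleExpect s (fun l => (if exceeds F α p l then 1 else 0) +
      if p * α ≤ (l.map fun c => 𝔼 i, F θ (s i) - F θ c).sum then 1 else 0) p [] := by
    refine (sampleExpect_const s 1 p []).symm.trans_le (sampleExpect_mono s p [] fun l hl => ?_)
    by_cases h : exceeds F α p l
    · rw [if_pos h]
      split_ifs <;> norm_num
    · rw [if_neg h, if_pos, zero_add]
      have hlt : (l.map fun c => F θ c - 𝔼 v, F θ v).sum < p * α :=
        not_le.1 fun hle => h ⟨θ, hle⟩
      rw [hsum l _ (𝔼 v, F θ v), hl]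
      simp only [List.length_nil, add_zero]
      nlinarith [mul_le_mul_of_nonneg_left hθ (Nat.cast_nonneg (α := ℝ) p)]
  rw [sampleExpect_add] at hone
  linarith

end Tests

/-! ### The distinguisher that tries all keys and all partial tables of the random function -/

namespace FiniteCode

variable {X K Kr Er Dr : Type} [DecidableEq X] [Fintype X] [Fintype K] [Fintype Kr] [Fintype Er]
  [Fintype Dr] [Nonempty K] [Nonempty Kr] [Nonempty Er] [Nonempty Dr] {n : ℕ}
  (S : FiniteCode X K Kr Er Dr n)

open Classical in
/-- The domain of the partial function listed by `g`. -/
noncomputable def tableDomain {N : ℕ} (g : Fin N → Option (X × Bool)) : Finset X :=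
  {x | ∃ i b, g i = some (x, b)}

open Classical in
noncomputable def tableValue {N : ℕ} (g : Fin N → Option (X × Bool)) (x : X) : Bool :=
  decide (∃ i, g i = some (x, true))

/-- Padding with `none` covers all sizes up to `N`, so there are `(2 * |X| + 1) ^ N` candidates in
the union bound. By `statistic_congr` the values of a table off its domain are irrelevant. -/
theorem exists_table {N : ℕ} (H : Finset X) (hH : H.card ≤ N) (ω : X → Bool) :
    ∃ g : Fin N → Option (X × Bool), tableDomain g = H ∧ ∀ x ∈ H, tableValue g x = ω x := by
  have hmem : ∀ x, x ∈ H ↔ ∃ i : Fin N, H.toList[(i : ℕ)]? = some x := by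
    intro x
    rw [← Finset.mem_toList, List.mem_iff_getElem?]
    constructor
    · rintro ⟨i, hi⟩
      have : i < H.toList.length := (List.getElem?_eq_some_iff.1 hi).1
      rw [Finset.length_toList] at this
      exact ⟨⟨i, this.trans_le hH⟩, hi⟩
    · rintro ⟨i, hi⟩
      exact ⟨i, hi⟩
  refine ⟨fun i => H.toList[(i : ℕ)]?.map fun x => (x, ω x), ?_, ?_⟩
  · ext x
    simp only [tableDomain, Finset.mem_filter, Finset.mem_univ, true_and, hmem,
      Option.map_eq_some_iff, Prod.mk.injEq]
    constructor
    · rintro ⟨i, b, y, hy, rfl, -⟩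
      exact ⟨i, hy⟩
    · rintro ⟨i, hi⟩
      exact ⟨i, ω x, x, hi, rfl, rfl⟩
  · intro x hx
    obtain ⟨i, hi⟩ := (hmem x).1 hx
    simp only [tableValue, Option.map_eq_some_iff, Prod.mk.injEq]
    cases hω : ω x
    · simp only [decide_eq_false_iff_not]
      rintro ⟨j, y, -, rfl, h⟩
      simp [hω] at h
    · simp only [decide_eq_true_eq]
      exact ⟨i, x, hi, rfl, hω⟩

omit [Fintype K] [Fintype Kr] [Fintype Er] [Nonempty K] [Nonempty Kr] [Nonempty Er]
  [Nonempty Dr] in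
theorem statistic_congr {ρ ε : ℝ} (k : K) {H : Finset X} {ω₁ ω₂ : X → Bool}
    (h : ∀ x ∈ H, ω₁ x = ω₂ x) : S.statistic ρ ε k H ω₁ = S.statistic ρ ε k H ω₂ := by
  have hp := patch_congr h
  have e1 : S.accProb k H ω₁ = S.accProb k H ω₂ := by
    funext y
    simp only [accProb, hp]
  have e2 : S.hitProb k H ω₁ = S.hitProb k H ω₂ := by
    funext x y
    simp only [hitProb, hp]
  funext c
  simp only [statistic, e1, e2]

/-- The statistics, scaled to `[0, 1]`, for all keys and all tables with `N` entries. -/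
noncomputable def tableStatistic (ρ ε : ℝ) (N : ℕ)
    (θ : K × (Fin N → Option (X × Bool))) (c : List.Vector Bool n) : ℝ :=
  S.statistic ρ ε θ.1 (tableDomain θ.2) (tableValue θ.2) c / (1 + S.queries / ε)

variable {ρ δ μ : ℝ}

omit [Fintype K] [Nonempty K] in
/-- With the right parameters, the statistics for the stopping sets of `exists_learned` have a larger
mean on encodings than on uniform strings. -/
theorem exists_stopping_gap (h0 : 0 ≤ ρ) (h1 : ρ ≤ 1) {m : ℕ} (hm : m ≠ 0)
    (hyp : ∀ f : List.Vector Bool n → ℝ, (∀ c, 0 ≤ f c) → (∀ c, f c ≤ 1) →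
      (𝔼 c, noiseOp ρ f c ^ 2) ^ m ≤ (𝔼 c, f c) ^ (m + 1))
    (hcomplete : 1 - δ ≤ 𝔼 r, 𝔼 ω, 𝔼 e, noiseOp ρ
      (fun y => 𝔼 d, if S.dec (S.key r ω) d y ω then (1 : ℝ) else 0) (S.enc (S.key r ω) e ω))
    (hsound : ∀ y, 𝔼 r, 𝔼 ω, 𝔼 d, (if S.dec (S.key r ω) d y ω then (1 : ℝ) else 0) ≤ μ)
    {ε t : ℝ} (hε : 0 < ε) (ht : 0 < t) :
    ∃ H : Kr → (X → Bool) → Finset X,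
      (∀ r, 𝔼 ω, ((H r ω).card : ℝ) ≤ S.queries + S.queries / t ^ m) ∧
      1 - δ - μ - S.queries * ε - S.queries * t / ε ≤
        𝔼 r, 𝔼 ω, (𝔼 e, S.statistic ρ ε (S.key r ω) (H r ω) ω (S.enc (S.key r ω) e ω) -
          𝔼 c, S.statistic ρ ε (S.key r ω) (H r ω) ω c) := by
  choose H hH hkey hcard hlight using fun r => S.exists_learned r (pow_pos ht m)
  refine ⟨H, hcard, ?_⟩
  simp only [Finset.expect_sub_distrib]
  have hreal : 1 - δ ≤ 𝔼 r, 𝔼 ω, 𝔼 e, S.statistic ρ ε (S.key r ω) (H r ω) ω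
      (S.enc (S.key r ω) e ω) + S.queries * ε := by
    refine hcomplete.trans ?_
    rw [← Fintype.expect_const (ι := Kr) (S.queries * ε), ← Finset.expect_add_distrib]
    exact Finset.expect_le_expect fun r _ => S.expect_dec_le h0 h1 hε (hH r) (hkey r)
  have hunif : 𝔼 r, 𝔼 ω, 𝔼 c, S.statistic ρ ε (S.key r ω) (H r ω) ω c ≤
      μ + S.queries * t / ε := by
    calc _ ≤ 𝔼 r, 𝔼 ω, (𝔼 y, S.accProb (S.key r ω) (H r ω) ω y + S.queries * t / ε) :=
          Finset.expect_le_expect fun r _ => Finset.expect_le_expect fun ω _ =>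
            S.expect_statistic_le hε hm ht.le hyp _ _ ω (hlight r ω)
      _ = 𝔼 y, 𝔼 r, 𝔼 ω, 𝔼 d, (if S.dec (S.key r ω) d y ω then (1 : ℝ) else 0) +
          S.queries * t / ε := by
          simp only [Finset.expect_add_distrib, Fintype.expect_const, S.expect_accProb (hH _) (hkey _)]
          congr 1
          rw [Finset.expect_comm (Finset.univ : Finset (List.Vector Bool n))]
          refine Finset.expect_congr rfl fun r _ => ?_
          exact Finset.expect_comm _ _ _
      _ ≤ μ + S.queries * t / ε := by
          gcongr
          exact Finset.expect_le Finset.univ_nonempty fun y _ => hsound y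
  linarith

theorem expect_ite_card_le {ι : Type*} [Fintype ι] {N : ℕ} (hN : 0 < N) (a : ι → ℕ) {A : ℝ}
    (h : 𝔼 i, (a i : ℝ) ≤ A) : 𝔼 i, (if a i ≤ N then (0 : ℝ) else 1) ≤ A / N := by
  have hN' : (0 : ℝ) < N := Nat.cast_pos.2 hN
  calc 𝔼 i, (if a i ≤ N then (0 : ℝ) else 1) ≤ 𝔼 i, (a i : ℝ) / N := by
        refine Finset.expect_le_expect fun i _ => ?_
        split_ifs with hi
        · positivity
        · rw [le_div_iff₀ hN', one_mul]
          exact_mod_cast (not_le.1 hi).le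
    _ ≤ A / N := by
        rw [← Finset.expect_div]
        gcongr

theorem expect_indicator_ge {ι : Type*} [Fintype ι] [Nonempty ι] {J : ι → ℝ} (hJ : ∀ i, J i ≤ 1)
    {α : ℝ} (h0 : 0 ≤ α) (h : 4 * α ≤ 𝔼 i, J i) :
    2 * α ≤ 𝔼 i, (if 2 * α ≤ J i then (1 : ℝ) else 0) := by
  have h2 : 𝔼 i, J i ≤ 𝔼 i, ((if 2 * α ≤ J i then (1 : ℝ) else 0) + 2 * α) := by
    refine Finset.expect_le_expect fun i _ => ?_
    split_ifs with hi
    · linarith [hJ i]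
    · linarith
  rw [Finset.expect_add_distrib, Fintype.expect_const] at h2
  linarith

/-- The number of table entries that the distinguisher considers. -/
def tableSize (T G m : ℕ) : ℕ := 4 * G * (1 + 8 * T ^ 2 * G) * (T * (1 + (64 * T ^ 2 * G ^ 2) ^ m))

/-- The number of samples that the distinguisher uses. -/
def sampleSize (T G M : ℕ) : ℕ :=
  256 * (1 + 8 * T ^ 2 * G) ^ 2 * G ^ 2 * (M + 16 * (1 + 8 * T ^ 2 * G) * G)

open Classical in
theorem exists_distinguisher (h0 : 0 ≤ ρ) (h1 : ρ ≤ 1) {m : ℕ} (hm : m ≠ 0)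
    (hyp : ∀ f : List.Vector Bool n → ℝ, (∀ c, 0 ≤ f c) → (∀ c, f c ≤ 1) →
      (𝔼 c, noiseOp ρ f c ^ 2) ^ m ≤ (𝔼 c, f c) ^ (m + 1))
    (hcomplete : 1 - δ ≤ 𝔼 r, 𝔼 ω, 𝔼 e, noiseOp ρ
      (fun y => 𝔼 d, if S.dec (S.key r ω) d y ω then (1 : ℝ) else 0) (S.enc (S.key r ω) e ω))
    (hsound : ∀ y, 𝔼 r, 𝔼 ω, 𝔼 d, (if S.dec (S.key r ω) d y ω then (1 : ℝ) else 0) ≤ μ)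
    {G M : ℕ} (hG : 0 < G) (hgap : 1 / (G : ℝ) ≤ 1 - δ - μ) (hT : 0 < S.queries)
    (hM : Fintype.card K * (2 * Fintype.card X + 1) ^ tableSize S.queries G m ≤ 2 ^ M) :
    ∃ D : List (List.Vector Bool n) → Bool,
      1 / (8 * (1 + 8 * S.queries ^ 2 * G) * G : ℝ) ≤
        𝔼 r, 𝔼 ω, sampleExpect (fun e => S.enc (S.key r ω) e ω) (fun l => if D l then 1 else 0)
          (sampleSize S.queries G M) [] -
        sampleExpect (fun v => v) (fun l => if D l then 1 else 0)
          (sampleSize S.queries G M) [] := by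
  obtain ⟨T, hTdef⟩ : ∃ T, S.queries = T := ⟨_, rfl⟩
  have hTR : (0 : ℝ) < T := by rw [← hTdef]; exact_mod_cast hT
  have hGR : (0 : ℝ) < G := by exact_mod_cast hG
  -- With these `ε` and `t`, the losses `queries * ε` and `queries * t / ε` of `exists_stopping_gap`
  -- are both `1 / (8 * G)`. The bound on the statistic is `b`, and `α` is the final advantage.
  set ε : ℝ := 1 / (8 * T * G) with hε_def
  set t : ℝ := 1 / (64 * T ^ 2 * G ^ 2) with ht_def
  set N := tableSize S.queries G m with hN_def
  set p := sampleSize S.queries G M with hp_def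
  set b : ℝ := 1 + 8 * T ^ 2 * G with hb_def
  set α : ℝ := 1 / (8 * b * G) with hα_def
  have hε : 0 < ε := by positivity
  have ht : 0 < t := by positivity
  have hb : 1 ≤ b := by rw [hb_def]; linarith [show (0 : ℝ) ≤ 8 * T ^ 2 * G by positivity]
  have hb0 : 0 < b := by linarith
  have hG1 : (1 : ℝ) ≤ G := by exact_mod_cast hG
  have hα : 0 < α := by positivity
  have hα1 : α ≤ 1 := by
    rw [hα_def, div_le_one (by positivity)]
    nlinarith
  have hb_eq : 1 + (S.queries : ℝ) / ε = b := by
    rw [hTdef, hε_def, hb_def]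
    field_simp
  have hN_eq : (N : ℝ) = 4 * G * b * (T * (1 + 1 / t ^ m)) := by
    rw [hN_def, tableSize, hTdef, ht_def, hb_def, div_pow, one_pow, one_div_one_div]
    push_cast
    ring
  have hN0 : 0 < N := by
    have : (0 : ℝ) < N := by rw [hN_eq]; positivity
    exact_mod_cast this
  obtain ⟨H, hcard, hH⟩ := S.exists_stopping_gap h0 h1 hm hyp hcomplete hsound hε ht
  let F := S.tableStatistic ρ ε N
  have hF0 : ∀ θ c, 0 ≤ F θ c := fun θ c =>
    div_nonneg (S.statistic_nonneg h0 h1 hε _ _ _ _) (by rw [hb_eq]; exact hb0.le)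
  have hF1 : ∀ θ c, F θ c ≤ 1 := fun θ c =>
    div_le_one_of_le₀ (S.statistic_le h0 h1 hε _ _ _ _) (by rw [hb_eq]; exact hb0.le)
  have hp_eq : (p : ℝ) * α ^ 2 / 4 = M + 16 * b * G := by
    rw [hp_def, sampleSize, hTdef, hα_def, hb_def]
    push_cast
    field_simp
    ring
  -- The summand `M` in `hp_eq` pays for the number of candidates; the summand `16 * b * G` brings
  -- the remaining error down to `α / 2`.
  have hexp : (Fintype.card (K × (Fin N → Option (X × Bool))) : ℝ) *
      Real.exp (-(p * α ^ 2 / 4)) ≤ α / 2 := by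
    have hc : (Fintype.card (K × (Fin N → Option (X × Bool))) : ℝ) ≤ Real.exp M := by
      have h2 : Fintype.card (K × (Fin N → Option (X × Bool))) ≤ 2 ^ M := by
        simpa [Fintype.card_option, mul_comm (Fintype.card X)] using hM
      calc (Fintype.card (K × (Fin N → Option (X × Bool))) : ℝ) ≤ 2 ^ M := by exact_mod_cast h2
        _ ≤ Real.exp 1 ^ M := by
          gcongr
          linarith [Real.add_one_le_exp (1 : ℝ)]
        _ = Real.exp M := by rw [← Real.exp_nat_mul, mul_one]
    calc _ ≤ Real.exp M * Real.exp (-(p * α ^ 2 / 4)) := by gcongr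
      _ = (Real.exp (16 * b * G))⁻¹ := by
        rw [hp_eq, ← Real.exp_add, ← Real.exp_neg]
        congr 1
        ring
      _ ≤ (16 * b * G)⁻¹ := by
        gcongr
        linarith [Real.add_one_le_exp (16 * b * G)]
      _ = α / 2 := by
        rw [hα_def]
        field_simp
        norm_num
  have hexp1 : Real.exp (-(p * α ^ 2 / 4)) ≤ α / 2 := by
    refine le_trans ?_ hexp
    refine le_mul_of_one_le_left (Real.exp_pos _).le ?_
    exact_mod_cast Fintype.card_pos
  refine ⟨fun l => decide (exceeds F α p l), ?_⟩
  simp only [decide_eq_true_eq]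
  have hideal := (sampleExpect_exceeds_le (p := p) hF0 hF1 hα.le hα1).trans hexp
  let gap : Kr × (X → Bool) → ℝ := fun i =>
    𝔼 e, S.statistic ρ ε (S.key i.1 i.2) (H i.1 i.2) i.2 (S.enc (S.key i.1 i.2) e i.2) -
      𝔼 c, S.statistic ρ ε (S.key i.1 i.2) (H i.1 i.2) i.2 c
  have hgap_le : ∀ i, gap i ≤ b := fun i => by
    have e1 : 𝔼 e, S.statistic ρ ε (S.key i.1 i.2) (H i.1 i.2) i.2
        (S.enc (S.key i.1 i.2) e i.2) ≤ b :=
      Finset.expect_le Finset.univ_nonempty fun e _ =>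
        (S.statistic_le h0 h1 hε _ _ _ _).trans_eq hb_eq
    have e2 : 0 ≤ 𝔼 c, S.statistic ρ ε (S.key i.1 i.2) (H i.1 i.2) i.2 c :=
      Finset.expect_nonneg fun c _ => S.statistic_nonneg h0 h1 hε _ _ _ _
    simp only [gap]
    linarith
  let J : Kr × (X → Bool) → ℝ := fun i => if (H i.1 i.2).card ≤ N then gap i / b else 0
  have hJ1 : ∀ i, J i ≤ 1 := fun i => by
    simp only [J]
    split_ifs
    · exact div_le_one_of_le₀ (hgap_le i) hb0.le
    · exact zero_le_one
  -- Markov's inequality; `tableSize` is chosen so that discarding the oversized sets costs at most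
  -- `1 / (4 * G)` of the gap.
  have hbad : 𝔼 i : Kr × (X → Bool), (if (H i.1 i.2).card ≤ N then (0 : ℝ) else 1) ≤
      1 / (4 * G * b) := by
    refine (expect_ite_card_le hN0 (fun i : Kr × (X → Bool) => (H i.1 i.2).card)
      (A := T * (1 + 1 / t ^ m)) ?_).trans_eq ?_
    · rw [← Finset.univ_product_univ, Finset.expect_product]
      refine Finset.expect_le Finset.univ_nonempty fun r _ => (hcard r).trans_eq ?_
      rw [hTdef]
      ring
    · rw [hN_eq]
      field_simp
  have hJ : 4 * α ≤ 𝔼 i, J i := by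
    have hsub : 𝔼 i, gap i - 1 / (4 * G) ≤ b * 𝔼 i, J i := by
      have e : 𝔼 i, gap i ≤ 𝔼 i, (b * J i + b * if (H i.1 i.2).card ≤ N then (0 : ℝ) else 1) := by
        refine Finset.expect_le_expect fun i _ => ?_
        simp only [J]
        split_ifs
        · rw [mul_div_cancel₀ _ hb0.ne']
          simp
        · linarith [hgap_le i]
      rw [Finset.expect_add_distrib, ← Finset.mul_expect, ← Finset.mul_expect] at e
      have e3 := mul_le_mul_of_nonneg_left hbad hb0.le
      have e4 : b * (1 / (4 * G * b)) = 1 / (4 * G) := by field_simp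
      linarith
    have hgap2 : 1 / (G : ℝ) - 1 / (8 * G) - 1 / (8 * G) ≤ 𝔼 i, gap i := by
      rw [← Finset.univ_product_univ, Finset.expect_product]
      refine le_trans ?_ hH
      have e1 : (S.queries : ℝ) * ε = 1 / (8 * G) := by
        rw [hTdef, hε_def]
        field_simp
      have e2 : (S.queries : ℝ) * t / ε = 1 / (8 * G) := by
        rw [hTdef, hε_def, ht_def]
        field_simp
        norm_num
      linarith
    refine le_of_mul_le_mul_left ?_ hb0
    refine le_trans ?_ hsub
    have e1 : b * (4 * α) = 1 / (2 * G) := by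
      rw [hα_def]
      field_simp
      norm_num
    have e2 : 1 / (G : ℝ) - 1 / (8 * G) - 1 / (8 * G) - 1 / (4 * G) = 1 / (2 * G) := by
      field_simp
      norm_num
    linarith
  have hind := expect_indicator_ge hJ1 hα.le hJ
  -- A fraction at least `2 * α` of the pairs is good and is detected up to error `α / 2`. Uniform
  -- strings are accepted with probability at most `α / 2`, which leaves advantage `α`.
  have hpoint : ∀ i : Kr × (X → Bool), (if 2 * α ≤ J i then (1 : ℝ) else 0) - α / 2 ≤
      sampleExpect (fun e => S.enc (S.key i.1 i.2) e i.2)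
        (fun l => if exceeds F α p l then 1 else 0) p [] := by
    intro i
    split_ifs with hi
    · have hle : (H i.1 i.2).card ≤ N := by
        by_contra hn
        simp only [J, if_neg hn] at hi
        linarith
      obtain ⟨g, hg, hgω⟩ := exists_table (H i.1 i.2) hle i.2
      have hFθ : ∀ c, F (S.key i.1 i.2, g) c =
          S.statistic ρ ε (S.key i.1 i.2) (H i.1 i.2) i.2 c / b := by
        intro c
        simp only [F, tableStatistic, hb_eq, hg]
        rw [S.statistic_congr _ hgω]
      refine le_trans (sub_le_sub_left hexp1 1)
        (le_sampleExpect_exceeds _ hF0 hF1 hα.le hα1 (S.key i.1 i.2, g) ?_)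
      simp only [hFθ, ← Finset.expect_div, ← sub_div]
      simpa only [J, if_pos hle] using hi
    · rw [zero_sub]
      refine le_trans (neg_nonpos.2 (by positivity)) ?_
      exact (sampleExpect_const (fun e => S.enc (S.key i.1 i.2) e i.2) 0 p []).symm.trans_le
        (sampleExpect_mono _ _ _ fun l _ => by split_ifs <;> norm_num)
  have hreal := Finset.expect_le_expect (s := Finset.univ) fun i _ => hpoint i
  have hprod := Finset.expect_product' Finset.univ Finset.univ fun r ω =>
    sampleExpect (fun e => S.enc (S.key r ω) e ω) (fun l => if exceeds F α p l then 1 else 0) p []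
  rw [Finset.univ_product_univ] at hprod
  rw [Finset.expect_sub_distrib, Fintype.expect_const, hprod] at hreal
  have hα_eq : 1 / (8 * (1 + 8 * (S.queries : ℝ) ^ 2 * G) * G) = α := by
    rw [hTdef, hα_def, hb_def]
  rw [hα_eq]
  linarith

end FiniteCode

/-! ### Queries and output lengths of oracle machines -/

namespace BitTape

/-- The number of listed cells apart from the scanned one. -/
def size (t : BitTape) : ℕ := t.left.length + t.right.length

theorem length_bitsOf_le : ∀ l : List (Option Bool), (bitsOf l).length ≤ l.length
  | [] => by simp [bitsOf]
  | none :: l => by simp [bitsOf]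
  | some b :: l => by simpa [bitsOf] using length_bitsOf_le l

theorem length_contents_le (t : BitTape) : t.contents.length ≤ t.size + 1 := by
  have := length_bitsOf_le (t.head :: t.right)
  simp only [List.length_cons] at this
  simp only [contents, size]
  omega

theorem size_update_le (t : BitTape) (s : Option Bool) (m : HeadMove) :
    (t.update s m).size ≤ t.size + 1 := by
  cases m <;> simp only [update, size, List.length_cons, List.length_tail] <;> omega

end BitTape

namespace OracleTM

variable {a : ℕ} (M : OracleTM a)

/-- The query, if any, that is made in the next step. -/
def asked (c : Cfg M) (coin : Bool) : Finset (List Bool) :=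
  match c.state with
  | none => ∅
  | some s =>
    match M.trans s (fun i => (c.tape i).head) coin with
    | .ask _ => {(c.tape .query).contents}
    | _ => ∅

/-- The queries made from the configuration `c` on, with the random bits `r`. -/
def askedFrom (O : List Bool → List Bool) : Cfg M → List Bool → Finset (List Bool)
  | _, [] => ∅
  | c, coin :: r => M.asked c coin ∪ askedFrom O (M.step O coin c) r

variable {M}

theorem step_congr {O O' : List Bool → List Bool} {c : Cfg M} {coin : Bool}
    (h : ∀ q ∈ M.asked c coin, O q = O' q) : M.step O coin c = M.step O' coin c := by
  simp only [asked] at h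
  simp only [step]
  cases hs : c.state with
  | none => rfl
  | some s =>
    simp only [hs] at h ⊢
    cases ht : M.trans s (fun i => (c.tape i).head) coin with
    | halt => rfl
    | act s' wr => rfl
    | ask s' =>
      simp only [ht] at h ⊢
      rw [h _ (Finset.mem_singleton_self _)]

/-- An adaptive computation is determined by the answers to the queries it makes; this is the source
of every `IsLocal` property of codes. -/
theorem askedFrom_congr {O O' : List Bool → List Bool} : ∀ (r : List Bool) (c : Cfg M),
    (∀ q ∈ M.askedFrom O c r, O q = O' q) → M.askedFrom O' c r = M.askedFrom O c r ∧
      r.foldl (fun c coin => M.step O' coin c) c = r.foldl (fun c coin => M.step O coin c) c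
  | [], _, _ => ⟨rfl, rfl⟩
  | coin :: r, c, h => by
    have e : M.step O' coin c = M.step O coin c :=
      (step_congr fun q hq => h q (Finset.mem_union_left _ hq)).symm
    simp only [askedFrom, List.foldl_cons, e]
    have := askedFrom_congr r (M.step O coin c) fun q hq => h q (Finset.mem_union_right _ hq)
    exact ⟨by rw [this.1], this.2⟩

theorem card_asked_le (c : Cfg M) (coin : Bool) : (M.asked c coin).card ≤ 1 := by
  unfold asked
  split
  · simp
  · split <;> simp

theorem card_askedFrom_le (O : List Bool → List Bool) : ∀ (r : List Bool) (c : Cfg M),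
    (M.askedFrom O c r).card ≤ r.length
  | [], _ => by simp [askedFrom]
  | coin :: r, c => by
    have h1 := card_asked_le c coin
    have h2 := card_askedFrom_le O r (M.step O coin c)
    have h3 := Finset.card_union_le (M.asked c coin) (M.askedFrom O (M.step O coin c) r)
    simp only [askedFrom, List.length_cons]
    omega

theorem size_query_step_le (O : List Bool → List Bool) (coin : Bool) (c : Cfg M) :
    ((M.step O coin c).tape .query).size ≤ (c.tape .query).size + 1 := by
  unfold step
  split
  · omega
  · split
    · simp
    · simp [BitTape.size, BitTape.blank]
    · exact BitTape.size_update_le _ _ _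

theorem size_output_step_le (O : List Bool → List Bool) (coin : Bool) (c : Cfg M) :
    ((M.step O coin c).tape .output).size ≤ (c.tape .output).size + 1 := by
  unfold step
  split
  · omega
  · split
    · simp
    · simp
    · exact BitTape.size_update_le _ _ _

theorem length_le_of_mem_asked {c : Cfg M} {coin : Bool} {q : List Bool}
    (h : q ∈ M.asked c coin) : q.length ≤ (c.tape .query).size + 1 := by
  unfold asked at h
  split at h
  · simp at h
  · split at h
    · rw [Finset.mem_singleton.1 h]
      exact BitTape.length_contents_le _
    · simp at h

theorem length_le_of_mem_askedFrom {O : List Bool → List Bool} {q : List Bool} :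
    ∀ (r : List Bool) (c : Cfg M), q ∈ M.askedFrom O c r →
      q.length ≤ (c.tape .query).size + r.length
  | [], _, h => by simp [askedFrom] at h
  | coin :: r, c, h => by
    rw [askedFrom, Finset.mem_union] at h
    rw [List.length_cons]
    rcases h with h | h
    · have := length_le_of_mem_asked h
      omega
    · have h1 := length_le_of_mem_askedFrom r _ h
      have h2 := size_query_step_le O coin c
      omega

theorem size_output_foldl_le (O : List Bool → List Bool) : ∀ (r : List Bool) (c : Cfg M),
    ((r.foldl (fun c coin => M.step O coin c) c).tape .output).size ≤
      (c.tape .output).size + r.length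
  | [], _ => by simp
  | coin :: r, c => by
    have h1 := size_output_foldl_le O r (M.step O coin c)
    have h2 := size_output_step_le O coin c
    simp only [List.foldl_cons, List.length_cons]
    omega

theorem length_result_le (O : List Bool → List Bool) (x : Fin a → List Bool) (r : List Bool) :
    (M.result O x r).length ≤ r.length + 1 := by
  have h1 := size_output_foldl_le O r (M.initial x)
  have h2 := BitTape.length_contents_le ((M.exec O x r).tape .output)
  have h3 : ((M.initial x).tape .output).size = 0 := rfl
  rw [h3] at h1
  simp only [exec] at h2
  simp only [result, exec]
  omega

end OracleTM

theorem Polynomial.eval_nat_mono (p : Polynomial ℕ) {x y : ℕ} (h : x ≤ y) :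
    p.eval x ≤ p.eval y := by
  rw [Polynomial.eval_eq_sum_range, Polynomial.eval_eq_sum_range]
  gcongr

namespace CryptoOracle

variable (B : CryptoOracle)

/-- The points at which the crypto oracle reads its secret function to answer the query `q`. -/
def points (R : List Bool → Bool) (q : List Bool) : Finset (List Bool) :=
  B.alg.machine.askedFrom (bitOracle R) (B.alg.machine.initial ![q])
    (List.replicate (B.alg.time.eval q.length) false)

variable {B}

theorem points_congr {R R' : List Bool → Bool} {q : List Bool}
    (h : ∀ z ∈ B.points R q, R z = R' z) : B.points R' q = B.points R q ∧ B.fn R' q = B.fn R q := by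
  have := OracleTM.askedFrom_congr (M := B.alg.machine) (O := bitOracle R) (O' := bitOracle R')
    (List.replicate (B.alg.time.eval q.length) false) (B.alg.machine.initial ![q])
    fun z hz => by simp only [bitOracle, h z hz]
  exact ⟨this.1, by simp only [fn, OracleTM.result, OracleTM.exec, this.2]⟩

theorem card_points_le (R : List Bool → Bool) (q : List Bool) :
    (B.points R q).card ≤ B.alg.time.eval q.length :=
  (OracleTM.card_askedFrom_le _ _ _).trans_eq (List.length_replicate ..)

theorem length_le_of_mem_points {R : List Bool → Bool} {q z : List Bool} (h : z ∈ B.points R q) :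
    z.length ≤ B.alg.time.eval q.length := by
  have h1 := OracleTM.length_le_of_mem_askedFrom _ _ h
  have h2 : ((B.alg.machine.initial ![q]).tape .query).size = 0 := rfl
  rwa [h2, List.length_replicate, zero_add] at h1

variable (B)

/-- The points at which the secret function is read during a run of `M` relative to the crypto
oracle. -/
def pointsOfRun {a : ℕ} (M : OracleTM a) (x : Fin a → List Bool) (r : List Bool)
    (R : List Bool → Bool) : Finset (List Bool) :=
  (M.askedFrom (B.fn R) (M.initial x) r).biUnion (B.points R)

variable {B} {a : ℕ} {M : OracleTM a} {x : Fin a → List Bool} {r : List Bool}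
  {R R' : List Bool → Bool}

theorem pointsOfRun_congr (h : ∀ z ∈ B.pointsOfRun M x r R, R z = R' z) :
    B.pointsOfRun M x r R' = B.pointsOfRun M x r R ∧
      M.result (B.fn R') x r = M.result (B.fn R) x r := by
  have hq : ∀ q ∈ M.askedFrom (B.fn R) (M.initial x) r,
      B.points R' q = B.points R q ∧ B.fn R' q = B.fn R q := fun q hq =>
    points_congr fun z hz => h z (Finset.mem_biUnion.2 ⟨q, hq, hz⟩)
  have := OracleTM.askedFrom_congr (O := B.fn R) (O' := B.fn R') r (M.initial x)
    fun q hq' => (hq q hq').2.symm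
  refine ⟨?_, by simp only [OracleTM.result, OracleTM.exec, this.2]⟩
  rw [pointsOfRun, pointsOfRun, this.1]
  exact Finset.biUnion_congr rfl fun q hq' => (hq q hq').1

theorem length_asked_initial {q : List Bool}
    (h : q ∈ M.askedFrom (B.fn R) (M.initial x) r) : q.length ≤ r.length := by
  have h1 := OracleTM.length_le_of_mem_askedFrom _ _ h
  have h2 : ((M.initial x).tape .query).size = 0 := rfl
  rwa [h2, zero_add] at h1

theorem card_pointsOfRun_le :
    (B.pointsOfRun M x r R).card ≤ r.length * B.alg.time.eval r.length := by
  refine (Finset.card_biUnion_le_card_mul _ _ (B.alg.time.eval r.length) fun q hq => ?_).trans ?_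
  · exact (card_points_le R q).trans (Polynomial.eval_nat_mono _ (length_asked_initial hq))
  · gcongr
    exact OracleTM.card_askedFrom_le _ _ _

/-- Each step lengthens a query by at most one symbol, both in the outer run and inside the crypto
oracle. This permits the restriction of the random function to short strings. -/
theorem length_le_of_mem_pointsOfRun {z : List Bool} (h : z ∈ B.pointsOfRun M x r R) :
    z.length ≤ B.alg.time.eval r.length := by
  obtain ⟨q, hq, hz⟩ := Finset.mem_biUnion.1 h
  exact (length_le_of_mem_points hz).trans (Polynomial.eval_nat_mono _ (length_asked_initial hq))

end CryptoOracle

/-! ### Probabilities as finite averages -/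

section Averages

variable {α β V : Type} [Fintype V] [Nonempty V]

theorem toReal_uniform_bind (g : V → PMF α) (a : α) :
    ((PMF.uniformOfFintype V).bind g a).toReal = 𝔼 v, (g v a).toReal := by
  rw [PMF.bind_apply, tsum_fintype, ENNReal.toReal_sum fun v _ =>
    ENNReal.mul_ne_top (PMF.apply_ne_top _ _) (PMF.apply_ne_top _ _),
    Fintype.expect_eq_sum_div_card, Finset.sum_div]
  refine Finset.sum_congr rfl fun v _ => ?_
  rw [ENNReal.toReal_mul, PMF.uniformOfFintype_apply, ENNReal.toReal_inv, ENNReal.toReal_natCast]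
  ring

theorem toReal_map_uniform_bind (s : V → β) (g : β → PMF α) (a : α) :
    (((PMF.uniformOfFintype V).map s).bind g a).toReal = 𝔼 v, (g (s v) a).toReal := by
  rw [PMF.bind_map, toReal_uniform_bind]
  rfl

open Classical in
theorem toReal_map_uniform (s : V → α) (a : α) :
    ((PMF.uniformOfFintype V).map s a).toReal = 𝔼 v, if s v = a then (1 : ℝ) else 0 := by
  rw [← PMF.bind_pure_comp, toReal_uniform_bind]
  refine Finset.expect_congr rfl fun v _ => ?_
  simp only [Function.comp_apply, PMF.pure_apply, eq_comm]
  split_ifs <;> simp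

theorem toReal_flipBit_bind (ρ : unitInterval) (g : Bool → PMF α) (a : α) :
    ((flipBit ρ).bind g a).toReal =
      (1 - ρ) / 2 * (g true a).toReal + (1 + ρ) / 2 * (g false a).toReal := by
  have h0 := ρ.2.1
  have h1 := ρ.2.2
  rw [PMF.bind_apply, tsum_fintype, Fintype.sum_bool, ENNReal.toReal_add
    (ENNReal.mul_ne_top (PMF.apply_ne_top _ _) (PMF.apply_ne_top _ _))
    (ENNReal.mul_ne_top (PMF.apply_ne_top _ _) (PMF.apply_ne_top _ _)),
    ENNReal.toReal_mul, ENNReal.toReal_mul]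
  simp only [flipBit, PMF.ofFintype_apply, if_true, Bool.false_eq_true, if_false]
  rw [ENNReal.toReal_ofReal (by linarith), ENNReal.toReal_ofReal (by linarith)]

theorem toReal_noise_bind (ρ : unitInterval) (a : α) : ∀ {n : ℕ} (c : List.Vector Bool n)
    (g : List Bool → PMF α), ((noise ρ c.toList).bind g a).toReal =
      noiseOp ρ (fun y : List.Vector Bool n => (g y.toList a).toReal) c
  | 0, c, g => by
    rw [noiseOp_zero, c.eq_nil]
    simp [noise]
  | n + 1, c, g => by
    obtain ⟨b, v, rfl⟩ := c.exists_eq_cons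
    have e : (noise ρ (b ::ᵥ v).toList).bind g = (flipBit ρ).bind fun e =>
        (noise ρ v.toList).bind fun y => g (xor b e :: y) := by
      rw [List.Vector.toList_cons, noise]
      change PMF.bind (PMF.bind _ fun e => PMF.bind _ fun y => PMF.pure _) g = _
      simp only [PMF.bind_bind, PMF.pure_bind]
    rw [e, toReal_flipBit_bind, toReal_noise_bind ρ a v, toReal_noise_bind ρ a v, noiseOp_cons]
    simp only [List.Vector.toList_cons, Bool.xor_true, Bool.xor_false]
    ring

end Averages

/-! ### Random functions on short strings -/

/-- All strings of length at most `L`. -/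
def shortStrings (L : ℕ) : Finset (List Bool) :=
  (Finset.range (L + 1)).biUnion fun i =>
    Finset.univ.image (List.Vector.toList : List.Vector Bool i → List Bool)

theorem mem_shortStrings {L : ℕ} {x : List Bool} : x ∈ shortStrings L ↔ x.length ≤ L := by
  simp only [shortStrings, Finset.mem_biUnion, Finset.mem_range, Finset.mem_image, Finset.mem_univ,
    true_and]
  constructor
  · rintro ⟨i, hi, v, rfl⟩
    rw [v.toList_length]
    omega
  · intro h
    exact ⟨x.length, by omega, ⟨x, rfl⟩, rfl⟩

theorem card_shortStrings_le (L : ℕ) : (shortStrings L).card ≤ 2 ^ (L + 1) := by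
  refine Finset.card_biUnion_le.trans ?_
  calc ∑ i ∈ Finset.range (L + 1), (Finset.univ.image
        (List.Vector.toList : List.Vector Bool i → List Bool)).card
      ≤ ∑ i ∈ Finset.range (L + 1), 2 ^ i := by
        refine Finset.sum_le_sum fun i _ => Finset.card_image_le.trans ?_
        simp
    _ ≤ 2 ^ (L + 1) := by
        rw [Nat.geomSum_eq le_rfl]
        simp

/-- The extension by `false` of a function on short strings. -/
def extendShort {L : ℕ} (ω : shortStrings L → Bool) : List Bool → Bool :=
  fun x => if h : x ∈ shortStrings L then ω ⟨x, h⟩ else false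

/-- The restriction of the infinite product measure to finitely many coordinates is the finite
product, which here is uniform. -/
theorem prob_singleton {α : Type} {L : ℕ} (game : (List Bool → Bool) → PMF α) (a : α)
    (hgame : ∀ R R', (∀ x ∈ shortStrings L, R x = R' x) → game R = game R') :
    prob game {a} = 𝔼 ω : shortStrings L → Bool, (game (extendShort ω) a).toReal := by
  have e : ∀ R, (game R).toOuterMeasure {a} =
      (fun ω : shortStrings L → Bool => game (extendShort ω) a) ((shortStrings L).restrict R) := by
    intro R
    rw [PMF.toOuterMeasure_apply_singleton]
    simp only
    rw [hgame R]
    intro x hx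
    simp [extendShort, hx]
  have hres := lintegral_restrict_infinitePi (s := shortStrings L)
    (μ := fun _ : List Bool => (PMF.uniformOfFintype Bool).toMeasure)
    (f := fun ω => game (extendShort ω) a) (measurable_of_countable _)
  rw [prob, lintegral_congr e, randomFunction, hres, lintegral_fintype, ENNReal.toReal_sum, Fintype.expect_eq_sum_div_card, Finset.sum_div]
  · refine Finset.sum_congr rfl fun ω _ => ?_
    rw [ENNReal.toReal_mul, div_eq_mul_inv]
    congr 1
    rw [Measure.pi_singleton]
    simp only [PMF.toMeasure_apply_singleton _ _ (measurableSet_singleton _),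
      PMF.uniformOfFintype_apply, Finset.prod_const, ENNReal.toReal_pow, ENNReal.toReal_inv,
      ENNReal.toReal_natCast, Fintype.card_fun, Nat.cast_pow, inv_pow, Finset.card_univ]
  · intro ω _
    exact ENNReal.mul_ne_top (PMF.apply_ne_top _ _) (measure_ne_top _ _)

/-! ### Codes relative to a crypto oracle as codes relative to a finite random function -/

theorem PMF.bind_congr_of_support {α β : Type} {p : PMF α} {f g : α → PMF β}
    (h : ∀ a ∈ p.support, f a = g a) : p.bind f = p.bind g := by
  ext b
  rw [PMF.bind_apply, PMF.bind_apply]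
  refine tsum_congr fun a => ?_
  by_cases ha : p a = 0
  · simp [ha]
  · rw [h a ((PMF.mem_support_iff _ _).2 ha)]

theorem length_of_mem_support_noise {ρ : unitInterval} :
    ∀ {c y : List Bool}, y ∈ (noise ρ c).support → y.length = c.length
  | [], y, h => by
    rw [noise, PMF.support_pure] at h
    rw [Set.mem_singleton_iff.1 h]
  | b :: c, y, h => by
    rw [noise] at h
    change y ∈ (PMF.bind _ fun e => PMF.bind _ fun y => PMF.pure _).support at h
    simp only [PMF.mem_support_bind_iff, PMF.support_pure, Set.mem_singleton_iff] at h
    obtain ⟨e, -, z, hz, rfl⟩ := h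
    rw [List.length_cons, List.length_cons, length_of_mem_support_noise hz]

namespace PPTMachine

variable {a : ℕ} {𝒪 : Set (List Bool → List Bool)} (M : PPTMachine a 𝒪)

theorem dist_eq (O : List Bool → List Bool) {x : Fin a → List Bool} {t : ℕ}
    (ht : M.time.eval (∑ i, (x i).length) = t) :
    M.dist O x = (PMF.uniformOfFintype (List.Vector Bool t)).map
      fun r => M.machine.result O x r.toList := by
  subst ht
  rfl

theorem result_mem_support (O : List Bool → List Bool) {x : Fin a → List Bool} {t : ℕ}
    (ht : M.time.eval (∑ i, (x i).length) = t) (r : List.Vector Bool t) :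
    M.machine.result O x r.toList ∈ (M.dist O x).support := by
  rw [M.dist_eq O ht, PMF.support_map, PMF.support_uniformOfFintype]
  exact ⟨r, trivial, rfl⟩

theorem length_le_of_mem_support {O : List Bool → List Bool} {x : Fin a → List Bool}
    {y : List Bool} (h : y ∈ (M.dist O x).support) :
    y.length ≤ M.time.eval (∑ i, (x i).length) + 1 := by
  rw [M.dist_eq O rfl, PMF.support_map] at h
  obtain ⟨r, -, rfl⟩ := h
  refine (OracleTM.length_result_le _ _ _).trans_eq ?_
  rw [r.toList_length]

end PPTMachine

theorem sum_length_three (x y z : List Bool) :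
    ∑ i, ((![x, y, z] : Fin 3 → List Bool) i).length = x.length + y.length + z.length := by
  simp [Fin.sum_univ_three]

theorem sum_length_one (x : List Bool) :
    ∑ i, ((![x] : Fin 1 → List Bool) i).length = x.length := by
  simp

namespace CryptoOracle

variable {B : CryptoOracle} {a : ℕ}

theorem fn_mem (R : List Bool → Bool) : B.fn R ∈ B.oracles := ⟨R, rfl⟩

theorem dist_congr (M : PPTMachine a B.oracles) {x : Fin a → List Bool} {u : ℕ}
    (hu : M.time.eval (∑ i, (x i).length) ≤ u) {R R' : List Bool → Bool}
    (h : ∀ z ∈ shortStrings (B.alg.time.eval u), R z = R' z) :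
    M.dist (B.fn R) x = M.dist (B.fn R') x := by
  rw [M.dist_eq _ rfl, M.dist_eq _ rfl]
  congr 1
  funext r
  refine (pointsOfRun_congr fun z hz => h z ?_).2.symm
  rw [mem_shortStrings]
  refine (length_le_of_mem_pointsOfRun hz).trans (Polynomial.eval_nat_mono _ ?_)
  rwa [r.toList_length]

/-- The points read during a run, as points of the finite random function. -/
def shortPointsOfRun (B : CryptoOracle) (M : OracleTM a) (x : Fin a → List Bool) (r : List Bool)
    {L : ℕ} (ω : shortStrings L → Bool) : Finset (shortStrings L) :=
  (B.pointsOfRun M x r (extendShort ω)).subtype (· ∈ shortStrings L)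

theorem isLocal_run (M : OracleTM a) (x : Fin a → List Bool) {r : List Bool} {u : ℕ}
    (hr : r.length ≤ u) :
    IsLocal (fun ω : shortStrings (B.alg.time.eval u) → Bool => B.shortPointsOfRun M x r ω)
      fun ω => M.result (B.fn (extendShort ω)) x r := by
  intro ω ω' h
  have := pointsOfRun_congr (B := B) (M := M) (x := x) (r := r) (R := extendShort ω)
    (R' := extendShort ω') fun z hz => by
      have hz' : z ∈ shortStrings (B.alg.time.eval u) := mem_shortStrings.2
        ((length_le_of_mem_pointsOfRun hz).trans (Polynomial.eval_nat_mono _ hr))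
      have := h ⟨z, hz'⟩ (Finset.mem_subtype.2 hz)
      simpa [extendShort, hz'] using this
  exact ⟨by simp only [shortPointsOfRun, this.1], this.2⟩

theorem card_shortPointsOfRun_le (M : OracleTM a) (x : Fin a → List Bool) {r : List Bool} {u : ℕ}
    (hr : r.length ≤ u) {L : ℕ} (ω : shortStrings L → Bool) :
    (B.shortPointsOfRun M x r ω).card ≤ u * B.alg.time.eval u + 1 := by
  rw [shortPointsOfRun, Finset.card_subtype]
  refine (Finset.card_filter_le _ _).trans (card_pointsOfRun_le.trans ?_)
  exact (Nat.mul_le_mul hr (Polynomial.eval_nat_mono _ hr)).trans (Nat.le_succ _)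

end CryptoOracle

theorem IsLocal.of_factor {X α β : Type} {q : (X → Bool) → Finset X} {f : (X → Bool) → α}
    {g : (X → Bool) → β} (h : IsLocal q f) (hg : ∀ ω ω', f ω' = f ω → g ω' = g ω) :
    IsLocal q g := fun ω ω' hω => ⟨(h ω ω' hω).1, hg _ _ (h ω ω' hω).2⟩

namespace OracleCode

variable {B : CryptoOracle} (C : OracleCode B) (κ : ℕ)

def keyTime : ℕ := C.keyGen.time.eval κ

def encTime : ℕ := C.enc.time.eval (κ + C.keyLen κ + C.msgLen κ)

def decTime : ℕ := C.dec.time.eval (κ + C.keyLen κ + C.codeLen κ)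

variable {κ}

theorem keyGen_time_eq : C.keyGen.time.eval (∑ i, ((![unary κ] : Fin 1 → List Bool) i).length) =
    C.keyTime κ := by
  rw [sum_length_one, keyTime, unary, List.length_replicate]

theorem enc_time_eq {sk m : List Bool} (hsk : sk.length = C.keyLen κ)
    (hm : m.length = C.msgLen κ) :
    C.enc.time.eval (∑ i, ((![unary κ, sk, m] : Fin 3 → List Bool) i).length) = C.encTime κ := by
  rw [sum_length_three, encTime, hsk, hm, unary, List.length_replicate]

theorem dec_time_eq {sk c : List Bool} (hsk : sk.length = C.keyLen κ)
    (hc : c.length = C.codeLen κ) :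
    C.dec.time.eval (∑ i, ((![unary κ, sk, c] : Fin 3 → List Bool) i).length) = C.decTime κ := by
  rw [sum_length_three, decTime, hsk, hc, unary, List.length_replicate]

/-- Polynomial key length is not part of the definition of a code; it follows because some key is
output, within the running time. -/
theorem keyLen_le : C.keyLen κ ≤ C.keyTime κ + 1 := by
  have hO := CryptoOracle.fn_mem (B := B) fun _ => false
  obtain ⟨sk, hsk⟩ := (C.keyGen.dist (B.fn fun _ => false) ![unary κ]).support_nonempty
  rw [← C.keyGen_length _ hO κ sk hsk, ← C.keyGen_time_eq]
  exact C.keyGen.length_le_of_mem_support hsk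

theorem codeLen_le : C.codeLen κ ≤ C.encTime κ + 1 := by
  have hO := CryptoOracle.fn_mem (B := B) fun _ => false
  have h1 : (List.replicate (C.keyLen κ) false).length = C.keyLen κ := List.length_replicate
  have h2 : (List.replicate (C.msgLen κ) false).length = C.msgLen κ := List.length_replicate
  obtain ⟨c, hc⟩ := (C.enc.dist (B.fn fun _ => false) ![unary κ, List.replicate (C.keyLen κ) false,
    List.replicate (C.msgLen κ) false]).support_nonempty
  rw [← C.enc_length _ hO κ _ _ h1 h2 c hc, ← C.enc_time_eq h1 h2]
  exact C.enc.length_le_of_mem_support hc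

variable (κ)

/-- A bound on the running times of the algorithms. -/
def TimeAtMost (u : ℕ) : Prop := C.keyTime κ ≤ u ∧ C.encTime κ ≤ u ∧ C.decTime κ ≤ u

variable {κ} {u : ℕ} (hu : C.TimeAtMost κ u) (m : List.Vector Bool (C.msgLen κ))

/-- The code for the fixed message `m` relative to the finite random function. -/
noncomputable def toFiniteCode : FiniteCode (shortStrings (B.alg.time.eval u))
    (List.Vector Bool (C.keyLen κ)) (List.Vector Bool (C.keyTime κ))
    (List.Vector Bool (C.encTime κ)) (List.Vector Bool (C.decTime κ)) (C.codeLen κ) where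
  key r ω := ⟨C.keyGen.machine.result (B.fn (extendShort ω)) ![unary κ] r.toList,
    C.keyGen_length _ (CryptoOracle.fn_mem _) κ _
      (C.keyGen.result_mem_support _ C.keyGen_time_eq r)⟩
  keyQ r ω := B.shortPointsOfRun C.keyGen.machine ![unary κ] r.toList ω
  key_local r := (CryptoOracle.isLocal_run C.keyGen.machine ![unary κ]
    (r.toList_length.trans_le hu.1)).of_factor fun _ _ h => Subtype.ext h
  enc k e ω := ⟨C.enc.machine.result (B.fn (extendShort ω)) ![unary κ, k.toList, m.toList] e.toList,
    C.enc_length _ (CryptoOracle.fn_mem _) κ _ _ k.toList_length m.toList_length _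
      (C.enc.result_mem_support _ (C.enc_time_eq k.toList_length m.toList_length) e)⟩
  encQ k e ω := B.shortPointsOfRun C.enc.machine ![unary κ, k.toList, m.toList] e.toList ω
  enc_local k e := (CryptoOracle.isLocal_run C.enc.machine ![unary κ, k.toList, m.toList]
    (e.toList_length.trans_le hu.2.1)).of_factor fun _ _ h => Subtype.ext h
  dec k d y ω := decide (readMessage
    (C.dec.machine.result (B.fn (extendShort ω)) ![unary κ, k.toList, y.toList] d.toList) =
      some m.toList)
  decQ k d y ω := B.shortPointsOfRun C.dec.machine ![unary κ, k.toList, y.toList] d.toList ω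
  dec_local k d y := (CryptoOracle.isLocal_run C.dec.machine ![unary κ, k.toList, y.toList]
    (d.toList_length.trans_le hu.2.2)).of_factor fun _ _ h => by simp only [h]
  -- The extra one makes the bound positive, as `exists_distinguisher` requires.
  queries := u * B.alg.time.eval u + 1
  keyQ_card r ω := CryptoOracle.card_shortPointsOfRun_le _ _ (r.toList_length.trans_le hu.1) ω
  encQ_card k e ω := CryptoOracle.card_shortPointsOfRun_le _ _ (e.toList_length.trans_le hu.2.1) ω
  decQ_card k d y ω := CryptoOracle.card_shortPointsOfRun_le _ _ (d.toList_length.trans_le hu.2.2) ω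

theorem sampleKey_extendShort (ω : shortStrings (B.alg.time.eval u) → Bool) :
    C.sampleKey (extendShort ω) κ = (PMF.uniformOfFintype (List.Vector Bool (C.keyTime κ))).map
      fun r => ((C.toFiniteCode hu m).key r ω).toList :=
  C.keyGen.dist_eq _ C.keyGen_time_eq

theorem encode_extendShort (ω : shortStrings (B.alg.time.eval u) → Bool)
    (k : List.Vector Bool (C.keyLen κ)) :
    C.encode (extendShort ω) κ k.toList m.toList =
      (PMF.uniformOfFintype (List.Vector Bool (C.encTime κ))).map
        fun e => ((C.toFiniteCode hu m).enc k e ω).toList :=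
  C.enc.dist_eq _ (C.enc_time_eq k.toList_length m.toList_length)

theorem toReal_decode_extendShort (ω : shortStrings (B.alg.time.eval u) → Bool)
    (k : List.Vector Bool (C.keyLen κ)) (y : List.Vector Bool (C.codeLen κ))
    (o : Option (List Bool)) :
    (C.decode (extendShort ω) κ k.toList y.toList o).toReal =
      𝔼 d : List.Vector Bool (C.decTime κ), if readMessage (C.dec.machine.result
        (B.fn (extendShort ω)) ![unary κ, k.toList, y.toList] d.toList) = o then (1 : ℝ) else 0 := by
  rw [decode, C.dec.dist_eq _ (C.dec_time_eq k.toList_length y.toList_length), PMF.map_comp,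
    toReal_map_uniform]
  refine Finset.expect_congr rfl fun d _ => ?_
  simp only [Function.comp_apply]
  congr

theorem toReal_decode_message (ω : shortStrings (B.alg.time.eval u) → Bool)
    (k : List.Vector Bool (C.keyLen κ)) (y : List.Vector Bool (C.codeLen κ)) :
    (C.decode (extendShort ω) κ k.toList y.toList (some m.toList)).toReal =
      𝔼 d, if (C.toFiniteCode hu m).dec k d y ω then (1 : ℝ) else 0 := by
  rw [toReal_decode_extendShort]
  refine Finset.expect_congr rfl fun d _ => ?_
  simp [toFiniteCode]

section Congr

variable {R R' : List Bool → Bool} (h : ∀ z ∈ shortStrings (B.alg.time.eval u), R z = R' z)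

include hu h

theorem sampleKey_congr : C.sampleKey R κ = C.sampleKey R' κ :=
  CryptoOracle.dist_congr C.keyGen (C.keyGen_time_eq.trans_le hu.1) h

theorem encode_congr {sk m : List Bool} (hsk : sk.length = C.keyLen κ)
    (hm : m.length = C.msgLen κ) : C.encode R κ sk m = C.encode R' κ sk m :=
  CryptoOracle.dist_congr C.enc ((C.enc_time_eq hsk hm).trans_le hu.2.1) h

theorem decode_congr {sk c : List Bool} (hsk : sk.length = C.keyLen κ)
    (hc : c.length = C.codeLen κ) : C.decode R κ sk c = C.decode R' κ sk c := by
  rw [decode, decode,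
    CryptoOracle.dist_congr C.dec ((C.dec_time_eq hsk hc).trans_le hu.2.2) h]

end Congr

theorem prob_completenessGame (ρ : ℕ → unitInterval) :
    prob (C.completenessGame ρ κ m.toList) {some m.toList} =
      𝔼 r, 𝔼 ω, 𝔼 e, noiseOp (ρ κ) (fun y => 𝔼 d,
        if (C.toFiniteCode hu m).dec ((C.toFiniteCode hu m).key r ω) d y ω then (1 : ℝ) else 0)
          ((C.toFiniteCode hu m).enc ((C.toFiniteCode hu m).key r ω) e ω) := by
  rw [prob_singleton (L := B.alg.time.eval u), Finset.expect_comm]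
  · refine Finset.expect_congr rfl fun ω _ => ?_
    change ((PMF.bind _ fun sk => PMF.bind _ fun c => PMF.bind _ fun c' => _) _).toReal = _
    rw [C.sampleKey_extendShort hu m, toReal_map_uniform_bind]
    refine Finset.expect_congr rfl fun r _ => ?_
    rw [C.encode_extendShort hu m, toReal_map_uniform_bind]
    refine Finset.expect_congr rfl fun e _ => ?_
    rw [toReal_noise_bind]
    simp only [C.toReal_decode_message hu m]
  · intro R R' h
    change PMF.bind _ (fun sk => PMF.bind _ fun c => PMF.bind _ fun c' => _) =
      PMF.bind _ fun sk => PMF.bind _ fun c => PMF.bind _ fun c' => _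
    rw [C.sampleKey_congr hu h]
    refine PMF.bind_congr_of_support fun sk hsk => ?_
    have hsk' := C.keyGen_length _ (CryptoOracle.fn_mem R') κ sk hsk
    rw [C.encode_congr hu h hsk' m.toList_length]
    refine PMF.bind_congr_of_support fun c hc => PMF.bind_congr_of_support fun c' hc' => ?_
    refine C.decode_congr hu h hsk' ?_
    rw [length_of_mem_support_noise hc']
    exact C.enc_length _ (CryptoOracle.fn_mem R') κ sk _ hsk' m.toList_length c hc

/-- Decoding to `m` and decoding to `⊥` are disjoint events, also for the empty message. -/
theorem expect_dec_le_of_sound {μ : ℕ → ℝ} (hμ : C.Sound μ) (y : List.Vector Bool (C.codeLen κ)) :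
    𝔼 r, 𝔼 ω, 𝔼 d, (if (C.toFiniteCode hu m).dec ((C.toFiniteCode hu m).key r ω) d y ω
      then (1 : ℝ) else 0) ≤ μ κ := by
  have hs := hμ κ y
  have hread : ∀ o : Option (List Bool), (if o = none then (1 : ℝ) else 0) ≤
      1 - if o = some m.toList then 1 else 0 := by
    rintro (_ | x)
    · simp
    · simp only [reduceCtorEq, if_false]
      split_ifs <;> norm_num
  rw [prob_singleton (L := B.alg.time.eval u)] at hs
  · have e : ∀ ω : shortStrings (B.alg.time.eval u) → Bool,
        (C.soundnessGame κ y.toList (extendShort ω) none).toReal ≤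
          1 - 𝔼 r, 𝔼 d, (if (C.toFiniteCode hu m).dec ((C.toFiniteCode hu m).key r ω) d y ω
            then (1 : ℝ) else 0) := by
      intro ω
      change ((PMF.bind _ fun sk => _) _).toReal ≤ _
      rw [C.sampleKey_extendShort hu m, toReal_map_uniform_bind,
        ← Fintype.expect_const (ι := List.Vector Bool (C.keyTime κ)) (1 : ℝ),
        ← Finset.expect_sub_distrib]
      refine Finset.expect_le_expect fun r _ => ?_
      rw [toReal_decode_extendShort,
        ← Fintype.expect_const (ι := List.Vector Bool (C.decTime κ)) (1 : ℝ),
        ← Finset.expect_sub_distrib]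
      refine Finset.expect_le_expect fun d _ => ?_
      simp only [toFiniteCode, decide_eq_true_eq, Fintype.expect_const]
      exact hread _
    have := hs.trans (Finset.expect_le_expect fun ω _ => e ω)
    rw [Finset.expect_sub_distrib, Fintype.expect_const, Finset.expect_comm] at this
    linarith
  · intro R R' h
    change PMF.bind _ (fun sk => _) = PMF.bind _ fun sk => _
    rw [C.sampleKey_congr hu h]
    refine PMF.bind_congr_of_support fun sk hsk => ?_
    exact C.decode_congr hu h (C.keyGen_length _ (CryptoOracle.fn_mem R') κ sk hsk) y.toList_length

end OracleCode

/-! ### The attack -/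

namespace Adversary

variable {k n : ℕ}

/-- Ask for `p` encodings of `m`, and apply the test `D` to them. -/
def sampleAndTest (m : List.Vector Bool k) (D : List (List.Vector Bool n) → Bool) :
    ℕ → List (List.Vector Bool n) → Adversary k
  | 0, l => .guess (D l)
  | p + 1, l => .askEnc m fun c =>
      -- The second branch only makes the tree total: both encoding oracles answer with strings of
      -- the right length.
      if h : c.length = n then sampleAndTest m D p (⟨c, h⟩ :: l) else .guess false

variable (m : List.Vector Bool k) (D : List (List.Vector Bool n) → Bool)

theorem costAtMost_sampleAndTest : ∀ (p : ℕ) (l : List (List.Vector Bool n)),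
    (sampleAndTest m D p l).CostAtMost p
  | 0, _ => trivial
  | p + 1, l => by
    refine ⟨by omega, fun c => ?_⟩
    beta_reduce
    split_ifs with h
    · exact costAtMost_sampleAndTest p _
    · trivial

theorem run_sampleAndTest_congr {E E' : List Bool → PMF (List Bool)}
    (O O' : List Bool → List Bool) (h : E m.toList = E' m.toList) :
    ∀ (p : ℕ) (l : List (List.Vector Bool n)),
      (sampleAndTest m D p l).run E O = (sampleAndTest m D p l).run E' O'
  | 0, _ => rfl
  | p + 1, l => by
    simp only [sampleAndTest, run, h]
    congr 1
    funext c
    split_ifs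
    · exact run_sampleAndTest_congr O O' h p _
    · rfl

theorem toReal_run_sampleAndTest {I : Type} [Fintype I] [Nonempty I] (s : I → List.Vector Bool n)
    {E : List Bool → PMF (List Bool)} (O : List Bool → List Bool)
    (hE : E m.toList = (PMF.uniformOfFintype I).map fun i => (s i).toList) :
    ∀ (p : ℕ) (l : List (List.Vector Bool n)), ((sampleAndTest m D p l).run E O true).toReal =
      sampleExpect s (fun l => if D l then 1 else 0) p l
  | 0, l => by
    simp only [sampleAndTest, run, sampleExpect, PMF.pure_apply]
    cases D l <;> simp
  | p + 1, l => by
    simp only [sampleAndTest, run, sampleExpect, hE]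
    rw [toReal_map_uniform_bind]
    refine Finset.expect_congr rfl fun i _ => ?_
    rw [dif_pos (s i).toList_length, ← toReal_run_sampleAndTest s O hE p]
    rfl

end Adversary

namespace OracleCode

variable {B : CryptoOracle} (C : OracleCode B) {κ u : ℕ} (hu : C.TimeAtMost κ u)
  (m : List.Vector Bool (C.msgLen κ)) (D : List (List.Vector Bool (C.codeLen κ)) → Bool) (p : ℕ)

theorem prob_realGame_sampleAndTest :
    prob (C.realGame κ (Adversary.sampleAndTest m D p [])) {true} =
      𝔼 r, 𝔼 ω, sampleExpect
        (fun e => (C.toFiniteCode hu m).enc ((C.toFiniteCode hu m).key r ω) e ω)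
        (fun l => if D l then 1 else 0) p [] := by
  rw [prob_singleton (L := B.alg.time.eval u), Finset.expect_comm]
  · refine Finset.expect_congr rfl fun ω _ => ?_
    change ((PMF.bind _ fun sk => _) _).toReal = _
    rw [C.sampleKey_extendShort hu m, toReal_map_uniform_bind]
    refine Finset.expect_congr rfl fun r _ => ?_
    exact Adversary.toReal_run_sampleAndTest m D _ _ (C.encode_extendShort hu m ω _) p []
  · intro R R' h
    change PMF.bind _ (fun sk => _) = PMF.bind _ fun sk => _
    rw [C.sampleKey_congr hu h]
    refine PMF.bind_congr_of_support fun sk hsk => ?_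
    exact Adversary.run_sampleAndTest_congr m D _ _ (C.encode_congr hu h
      (C.keyGen_length _ (CryptoOracle.fn_mem R') κ sk hsk) m.toList_length) p []

theorem prob_idealGame_sampleAndTest :
    prob (C.idealGame κ (Adversary.sampleAndTest m D p [])) {true} =
      sampleExpect (fun v => v) (fun l => if D l then 1 else 0) p [] := by
  -- The adversary never calls `B^R`, so the ideal game does not depend on the random function at
  -- all.
  rw [prob_singleton (L := 0)]
  · simp only [idealGame]
    simp only [Adversary.toReal_run_sampleAndTest m D (fun v => v)
      (E := fun _ => uniformString (C.codeLen κ)) _ rfl, Fintype.expect_const]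
  · intro R R' _
    exact Adversary.run_sampleAndTest_congr m D _ _ rfl p []

open FiniteCode in
/-- A gap between completeness and soundness gives an adversary with a large advantage. -/
theorem exists_adversary {ρ : ℕ → unitInterval} {δ μ : ℕ → ℝ} (hδ : C.Complete ρ δ)
    (hμ : C.Sound μ) {u : ℕ} (hu : C.TimeAtMost κ u) {j : ℕ}
    (hj : (ρ κ : ℝ) ^ 2 ^ j ≤ 1 / 2) {G T L M : ℕ} (hG : 0 < G)
    (hgap : 1 / (G : ℝ) ≤ 1 - δ κ - μ κ) (hL : L = B.alg.time.eval u) (hT : T = u * L + 1)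
    (hM : M = u + 1 + (L + 3) * tableSize T G (2 ^ (j + 1))) :
    ∃ A : Adversary (C.msgLen κ), A.CostAtMost (sampleSize T G M) ∧
      1 / (8 * (1 + 8 * T ^ 2 * G) * G : ℝ) ≤
        |prob (C.realGame κ A) {true} - prob (C.idealGame κ A) {true}| := by
  let m : List.Vector Bool (C.msgLen κ) := List.Vector.replicate _ false
  have hq : (C.toFiniteCode hu m).queries = T := by rw [hT, hL]; rfl
  -- There are at most `2 ^ (u + 1)` keys, and `2 * 2 ^ (L + 1) + 1 ≤ 2 ^ (L + 3)` possible table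
  -- entries.
  have hMcard : Fintype.card (List.Vector Bool (C.keyLen κ)) *
      (2 * Fintype.card (shortStrings (B.alg.time.eval u)) + 1) ^
        tableSize (C.toFiniteCode hu m).queries G (2 ^ (j + 1)) ≤ 2 ^ M := by
    rw [hq, hM, pow_add 2 (u + 1), pow_mul 2 (L + 3), card_vector, Fintype.card_bool, Fintype.card_coe, ← hL]
    gcongr
    · exact one_le_two
    · have := C.keyLen_le (κ := κ)
      have := hu.1
      omega
    · have := card_shortStrings_le L
      have e : 2 ^ (L + 3) = 4 * 2 ^ (L + 1) := by ring
      have := Nat.one_le_two_pow (n := L + 1)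
      omega
  have hcomp := hδ κ m
  rw [C.prob_completenessGame hu m] at hcomp
  obtain ⟨D, hD⟩ := (C.toFiniteCode hu m).exists_distinguisher (ρ κ).2.1 (ρ κ).2.2
    (m := 2 ^ (j + 1)) (by positivity) (fun f h0 h1 => hypercontractive j (ρ κ).2.1 hj f h0 h1)
    hcomp (C.expect_dec_le_of_sound hu m hμ) hG hgap (by rw [hq, hT]; omega) hMcard
  rw [hq] at hD
  refine ⟨Adversary.sampleAndTest m D (sampleSize T G M) [],
    Adversary.costAtMost_sampleAndTest _ _ _ _, ?_⟩
  rw [C.prob_realGame_sampleAndTest hu, C.prob_idealGame_sampleAndTest]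
  exact hD.trans (le_abs_self _)

/-- The bounds chain: key time bounds the key length, hence the encoding time, hence the codeword
length and the decoding time. -/
theorem exists_time_polynomial : ∃ U : Polynomial ℕ, ∀ κ, C.TimeAtMost κ (U.eval κ) := by
  obtain ⟨pm, hpm⟩ := C.msgLen_poly
  let Pe : Polynomial ℕ := C.enc.time.comp (Polynomial.X + (C.keyGen.time + 1) + pm)
  let Pd : Polynomial ℕ := C.dec.time.comp (Polynomial.X + (C.keyGen.time + 1) + (Pe + 1))
  refine ⟨C.keyGen.time + Pe + Pd, fun κ => ?_⟩
  have hkey := C.keyLen_le (κ := κ)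
  have hcode := C.codeLen_le (κ := κ)
  have he : C.encTime κ ≤ Pe.eval κ := by
    simp only [Pe, Polynomial.eval_comp, Polynomial.eval_add, Polynomial.eval_X,
      Polynomial.eval_one]
    refine Polynomial.eval_nat_mono _ ?_
    have := hpm κ
    rw [keyTime] at hkey
    omega
  have hd : C.decTime κ ≤ Pd.eval κ := by
    simp only [Pd, Polynomial.eval_comp, Polynomial.eval_add, Polynomial.eval_X,
      Polynomial.eval_one]
    refine Polynomial.eval_nat_mono _ ?_
    rw [keyTime] at hkey
    omega
  simp only [Polynomial.eval_add]
  refine ⟨?_, ?_, ?_⟩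
  · rw [keyTime]
    omega
  · omega
  · omega

end OracleCode

/-! ### Asymptotics: negligible functions and polynomial bounds -/

theorem ConstantRate.exists_pow_le {ρ : ℕ → unitInterval} (hρ : ConstantRate ρ) :
    ∃ j : ℕ, ∀ᶠ κ in atTop, (ρ κ : ℝ) ^ 2 ^ j ≤ 1 / 2 := by
  obtain ⟨c, hc, h⟩ := hρ
  obtain ⟨i, hi⟩ := exists_pow_lt_of_lt_one (show (0 : ℝ) < 1 / 2 by norm_num)
    (show max 0 (1 - c) < 1 from max_lt one_pos (by linarith))
  refine ⟨i, h.mono fun κ hκ => ?_⟩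
  calc (ρ κ : ℝ) ^ 2 ^ i ≤ (ρ κ : ℝ) ^ i :=
        pow_le_pow_of_le_one (ρ κ).2.1 (ρ κ).2.2 Nat.lt_two_pow_self.le
    _ ≤ max 0 (1 - c) ^ i := pow_le_pow_left₀ (ρ κ).2.1 (hκ.trans (le_max_right _ _)) i
    _ ≤ 1 / 2 := hi.le

theorem Negligible.eventually_lt {f : ℕ → ℝ} (hf : Negligible f) (Q : Polynomial ℕ)
    (hQ : ∀ κ, 0 < Q.eval κ) : ∀ᶠ κ in atTop, f κ < 1 / ((Q.eval κ : ℕ) : ℝ) := by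
  have h := hf.polynomial_mul (Q.map (Nat.castRingHom ℝ)) 0
  simp only [pow_zero, one_mul, Polynomial.eval_natCast_map, eq_natCast] at h
  filter_upwards [h.eventually (gt_mem_nhds one_pos)] with κ hκ
  have : (0 : ℝ) < Q.eval κ := by exact_mod_cast hQ κ
  rw [lt_div_iff₀ this, mul_comm]
  exact hκ

theorem negligible_of_eventually_lt {f : ℕ → ℝ} (h0 : ∀ κ, 0 ≤ f κ)
    (h : ∀ c : ℕ, ∀ᶠ κ : ℕ in atTop, f κ < 1 / ((κ + 1 : ℝ) ^ c)) : Negligible f := by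
  intro c
  refine squeeze_zero' (Eventually.of_forall fun κ => mul_nonneg (by positivity) (h0 κ)) ?_
    tendsto_one_div_add_atTop_nhds_zero_nat
  filter_upwards [h (c + 1)] with κ hκ
  calc (κ : ℝ) ^ c * f κ ≤ (κ + 1 : ℝ) ^ c * (1 / (κ + 1 : ℝ) ^ (c + 1)) := by
        gcongr
        · exact h0 κ
        · linarith
    _ = 1 / (κ + 1 : ℝ) := by
        field_simp
        ring

open FiniteCode in
-- For each `c`, a gap of at least `1 / (κ + 1) ^ c` at infinitely many `κ` would give a
-- polynomial-cost adversary with inverse polynomial advantage there. The constant noise rate makes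
-- `j` independent of `κ`, so that `tableSize` is polynomial.
theorem OracleCode.negligible_gap {B : CryptoOracle} (C : OracleCode B) {ρ : ℕ → unitInterval}
    (hρ : ConstantRate ρ) {δ μ : ℕ → ℝ} (hC : C.StatPseudorandom) (hδ : C.Complete ρ δ)
    (hμ : C.Sound μ) : Negligible fun κ => max 0 (1 - δ κ - μ κ) := by
  classical
  refine negligible_of_eventually_lt (fun κ => le_max_left _ _) fun c => ?_
  obtain ⟨U, hU⟩ := C.exists_time_polynomial
  obtain ⟨j, hj⟩ := hρ.exists_pow_le
  let G : ℕ → ℕ := fun κ => (κ + 1) ^ c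
  let L : ℕ → ℕ := fun κ => B.alg.time.eval (U.eval κ)
  let T : ℕ → ℕ := fun κ => U.eval κ * L κ + 1
  let M : ℕ → ℕ := fun κ => U.eval κ + 1 + (L κ + 3) * tableSize (T κ) (G κ) (2 ^ (j + 1))
  have hGpos : ∀ κ, 0 < G κ := fun κ => by positivity
  -- Where there is no gap a constant guess is used, so that one family is defined for all `κ`.
  have hex : ∀ κ, ∃ A : Adversary (C.msgLen κ), A.CostAtMost (sampleSize (T κ) (G κ) (M κ)) ∧
      ((ρ κ : ℝ) ^ 2 ^ j ≤ 1 / 2 → 1 / (G κ : ℝ) ≤ 1 - δ κ - μ κ →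
        1 / (8 * (1 + 8 * T κ ^ 2 * G κ) * G κ : ℝ) ≤
          |prob (C.realGame κ A) {true} - prob (C.idealGame κ A) {true}|) := by
    intro κ
    by_cases h : (ρ κ : ℝ) ^ 2 ^ j ≤ 1 / 2 ∧ 1 / (G κ : ℝ) ≤ 1 - δ κ - μ κ
    · obtain ⟨A, hA, hadv⟩ := C.exists_adversary hδ hμ (hU κ) h.1 (hGpos κ) h.2 rfl rfl rfl
      exact ⟨A, hA, fun _ _ => hadv⟩
    · exact ⟨.guess false, trivial, fun h1 h2 => absurd ⟨h1, h2⟩ h⟩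
  choose A hcost hadv using hex
  let GP : Polynomial ℕ := (Polynomial.X + 1) ^ c
  let LP : Polynomial ℕ := B.alg.time.comp U
  let TP : Polynomial ℕ := U * LP + 1
  let bP : Polynomial ℕ := 1 + 8 * TP ^ 2 * GP
  let MP : Polynomial ℕ := U + 1 + (LP + 3) *
    (4 * GP * bP * (TP * (1 + (64 * TP ^ 2 * GP ^ 2) ^ 2 ^ (j + 1))))
  have hneg := hC A ⟨256 * bP ^ 2 * GP ^ 2 * (MP + 16 * bP * GP), fun κ => by
    have e : Polynomial.eval κ (256 * bP ^ 2 * GP ^ 2 * (MP + 16 * bP * GP)) =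
        sampleSize (T κ) (G κ) (M κ) := by
      simp only [sampleSize, tableSize, T, G, M, L, MP, bP, TP, LP, GP, Polynomial.eval_add,
        Polynomial.eval_mul, Polynomial.eval_pow, Polynomial.eval_comp, Polynomial.eval_X,
        Polynomial.eval_one, Polynomial.eval_ofNat]
    rw [e]
    exact hcost κ⟩
  have hlt := Negligible.eventually_lt hneg (8 * bP * GP) fun κ => by
    simp only [bP, GP, Polynomial.eval_add, Polynomial.eval_mul, Polynomial.eval_pow,
      Polynomial.eval_X, Polynomial.eval_one, Polynomial.eval_ofNat]
    positivity
  filter_upwards [hlt, hj] with κ h1 h2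
  refine max_lt (by positivity) (lt_of_not_ge fun h3 => ?_)
  have h4 := hadv κ h2 (by simpa [G] using h3)
  refine absurd (h4.trans_lt h1) (not_lt.2 (le_of_eq ?_))
  simp only [bP, GP, TP, LP, T, G, L, Polynomial.eval_add, Polynomial.eval_mul,
    Polynomial.eval_pow, Polynomial.eval_X, Polynomial.eval_one, Polynomial.eval_ofNat,
    Polynomial.eval_comp]
  push_cast
  rfl

theorem mainTheorem2 (B : CryptoOracle) (ρ : ℕ → unitInterval) (hρ : ConstantRate ρ) :
    (¬ ∃ C : OracleCode B, C.IsStatPRC ρ) ∧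
    ∀ (C : OracleCode B) (δ μ : ℕ → ℝ),
      C.StatPseudorandom → C.Complete ρ δ → C.Sound μ →
        ∃ ν : ℕ → ℝ, Negligible ν ∧ ∀ κ, 1 - ν κ ≤ δ κ + μ κ := by
  constructor
  · rintro ⟨C, hC, ⟨δ, hδ, hδC⟩, μ, hμ, hμC⟩
    -- This sum is always at least 1, yet it would be negligible.
    have h := (C.negligible_gap hρ hC hδC hμC).add (hδ.add hμ)
    obtain ⟨κ, hκ⟩ := (Negligible.eventually_lt h 1 fun κ => by simp).exists
    have := le_max_right 0 (1 - δ κ - μ κ)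
    simp only [Pi.add_apply, Polynomial.eval_one, Nat.cast_one, div_one] at hκ
    linarith
  · intro C δ μ hC hδ hμ
    refine ⟨_, C.negligible_gap hρ hC hδ hμ, fun κ => ?_⟩
    have := le_max_right 0 (1 - δ κ - μ κ)
    linarith
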